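/- Let $C$ be a field of characteristic zero and let $K_0=(C(x),d/dx)$. If $K$ is a differential field whose field of constants is $C$ and $t$ lies in a differential field extension of $K$, call $t$ a *logarithmic generator* over $K$ if $t$ is transcendental over $K$, $K(t)$ has the same constants as $K$, and $t'$ is a $C$-linear combination of logarithmic derivatives $g'/g$ with $g\in K\setminus\{0\}$. A *logarithmic tower* $K_0(t_1,\dots,t_n)$ is a differential field extension $K_n$ of $K_0$ generated as a field over $K_0$ by $t_1,\dots,t_n$, such that, with $K_i=K_0(t_1,\dots,t_i)$, each $t_i$ is a logarithmic generator over $K_{i-1}$. In such a tower, an element of $K_i$ $(1\le i\le n)$ is *$t_i$-proper* if, as a rational function in $t_i$ over $K_{i-1}$, its numerator has lower degree than its denominator (zero is proper). Put $P_0=K_0[t_1,\dots,t_n]$, and for $1\le i\le n$ let $P_i$ be the additive group of all linear combinations of monomials in $t_{i+1},\dots,t_n$ with $t_i$-proper coefficients. Then $K_n=\bigoplus_{i=0}^n P_i$; let $\pi_i:K_n\to P_i$ be the projections. For $f\in K_n\setminus\{0\}$ the *significant index* of $f$ is $\mathrm{si}(f)=\max\{i:\pi_i(f)\ne0\}$.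 The *significant vector* of the tower is $(k_1,\dots,k_n)$ with $k_j=\mathrm{si}(t_j')$, its *significant components* are $\pi_{k_1}(t_1'),\dots,\pi_{k_n}(t_n')$, and its *associated matrix* is the $n\times n$ matrix $(\pi_i(t_j'))_{0\le i\le n-1,\,1\le j\le n}$. The tower is *well-generated* if its significant components are $C$-linearly independent, $k_1\le k_2\le\dots\le k_n$, and each column of its associated matrix has exactly one nonzero entry. **Theorem.** For every logarithmic tower $K_0(t_1,\dots,t_n)$ there exist an integer $w$ with $n\le w\le n(n+1)/2$, a well-generated logarithmic tower $K_0(u_1,\dots,u_w)$, and an injective field homomorphism $\phi:K_0(t_1,\dots,t_n)\to K_0(u_1,\dots,u_w)$ that commutes with the derivations and is the identity on $K_0$. -/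

import Mathlib

universe u v

open scoped Differential

noncomputable section

namespace LogTower

/-! ### The differential field `(C(x), d/dx)` -/

/-- The differential ring structure given by an additive map that satisfies the Leibniz rule. -/
@[reducible]
def differentialOf {R : Type*} [CommRing R] (d : R → R) (hadd : ∀ a b, d (a + b) = d a + d b)
    (hmul : ∀ a b, d (a * b) = a * d b + b * d a) : Differential R where
  deriv := Derivation.mk' (AddMonoidHom.mk' d hadd).toIntLinearMap hmul

section RationalFunctions

variable {C : Type*} [Field C]

/-- The derivative `d/dx` of a rational function, by the quotient rule. -/
def ratDeriv (f : RatFunc C) : RatFunc C :=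
  (algebraMap (Polynomial C) (RatFunc C) (Polynomial.derivative f.num) *
      algebraMap (Polynomial C) (RatFunc C) f.denom -
    algebraMap (Polynomial C) (RatFunc C) f.num *
      algebraMap (Polynomial C) (RatFunc C) (Polynomial.derivative f.denom)) /
    algebraMap (Polynomial C) (RatFunc C) f.denom ^ 2

/-- The quotient rule holds for every representation as a fraction. -/
theorem ratDeriv_div (p q : Polynomial C) (hq : q ≠ 0) :
    ratDeriv (algebraMap (Polynomial C) (RatFunc C) p / algebraMap (Polynomial C) (RatFunc C) q) =
      (algebraMap (Polynomial C) (RatFunc C) (Polynomial.derivative p) *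
          algebraMap (Polynomial C) (RatFunc C) q -
        algebraMap (Polynomial C) (RatFunc C) p *
          algebraMap (Polynomial C) (RatFunc C) (Polynomial.derivative q)) /
        algebraMap (Polynomial C) (RatFunc C) q ^ 2 := by
  set f : RatFunc C :=
    algebraMap (Polynomial C) (RatFunc C) p / algebraMap (Polynomial C) (RatFunc C) q with hf
  have hq' : algebraMap (Polynomial C) (RatFunc C) q ≠ 0 := RatFunc.algebraMap_ne_zero hq
  have hd' : algebraMap (Polynomial C) (RatFunc C) f.denom ≠ 0 :=
    RatFunc.algebraMap_ne_zero f.denom_ne_zero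
  have h0 : algebraMap (Polynomial C) (RatFunc C) f.num *
      algebraMap (Polynomial C) (RatFunc C) q =
      algebraMap (Polynomial C) (RatFunc C) p * algebraMap (Polynomial C) (RatFunc C) f.denom := by
    have h := RatFunc.num_div_denom f
    rw [hf, div_eq_div_iff hd' hq'] at h
    exact h
  have h1 : f.num * q = p * f.denom := by
    apply RatFunc.algebraMap_injective C
    simpa using h0
  have h2 := congrArg (fun r => algebraMap (Polynomial C) (RatFunc C) (Polynomial.derivative r)) h1
  simp only [Polynomial.derivative_mul, map_add, map_mul] at h2
  rw [ratDeriv, div_eq_div_iff (pow_ne_zero 2 hd') (pow_ne_zero 2 hq')]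
  generalize algebraMap (Polynomial C) (RatFunc C) f.num = a at *
  generalize algebraMap (Polynomial C) (RatFunc C) f.denom = d at *
  generalize algebraMap (Polynomial C) (RatFunc C) p = P at *
  generalize algebraMap (Polynomial C) (RatFunc C) q = Q at *
  generalize algebraMap (Polynomial C) (RatFunc C) (Polynomial.derivative f.num) = a' at *
  generalize algebraMap (Polynomial C) (RatFunc C) (Polynomial.derivative f.denom) = d' at *
  generalize algebraMap (Polynomial C) (RatFunc C) (Polynomial.derivative p) = P' at *
  generalize algebraMap (Polynomial C) (RatFunc C) (Polynomial.derivative q) = Q' at *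
  linear_combination (Q * d) * h2 - (Q * d' + d * Q') * h0

theorem ratDeriv_add (f g : RatFunc C) : ratDeriv (f + g) = ratDeriv f + ratDeriv g := by
  have hf := RatFunc.algebraMap_ne_zero f.denom_ne_zero
  have hg := RatFunc.algebraMap_ne_zero g.denom_ne_zero
  have h : f + g = algebraMap (Polynomial C) (RatFunc C) (f.num * g.denom + g.num * f.denom) /
      algebraMap (Polynomial C) (RatFunc C) (f.denom * g.denom) := by
    conv_lhs => rw [← RatFunc.num_div_denom f, ← RatFunc.num_div_denom g]
    rw [div_add_div _ _ hf hg]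
    simp [mul_comm]
  rw [h, ratDeriv_div _ _ (mul_ne_zero f.denom_ne_zero g.denom_ne_zero), ratDeriv, ratDeriv]
  simp only [Polynomial.derivative_mul, map_add, map_mul]
  field_simp
  ring

theorem ratDeriv_mul (f g : RatFunc C) :
    ratDeriv (f * g) = f * ratDeriv g + g * ratDeriv f := by
  have hf := RatFunc.algebraMap_ne_zero f.denom_ne_zero
  have hg := RatFunc.algebraMap_ne_zero g.denom_ne_zero
  have h : f * g = algebraMap (Polynomial C) (RatFunc C) (f.num * g.num) /
      algebraMap (Polynomial C) (RatFunc C) (f.denom * g.denom) := by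
    conv_lhs => rw [← RatFunc.num_div_denom f, ← RatFunc.num_div_denom g]
    rw [div_mul_div_comm]
    simp
  have hF : f = algebraMap (Polynomial C) (RatFunc C) f.num /
      algebraMap (Polynomial C) (RatFunc C) f.denom := (RatFunc.num_div_denom f).symm
  have hG : g = algebraMap (Polynomial C) (RatFunc C) g.num /
      algebraMap (Polynomial C) (RatFunc C) g.denom := (RatFunc.num_div_denom g).symm
  have key : ratDeriv (f * g) =
      (algebraMap (Polynomial C) (RatFunc C) f.num /
        algebraMap (Polynomial C) (RatFunc C) f.denom) * ratDeriv g +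
      (algebraMap (Polynomial C) (RatFunc C) g.num /
        algebraMap (Polynomial C) (RatFunc C) g.denom) * ratDeriv f := by
    rw [h, ratDeriv_div _ _ (mul_ne_zero f.denom_ne_zero g.denom_ne_zero), ratDeriv, ratDeriv]
    simp only [Polynomial.derivative_mul, map_add, map_mul]
    field_simp
    ring
  rw [← hF, ← hG] at key
  exact key

/-- `C(x)` as a differential field, with the derivation `d/dx`. -/
instance ratFuncDifferential : Differential (RatFunc C) :=
  differentialOf ratDeriv ratDeriv_add ratDeriv_mul

theorem ratFunc_deriv (f : RatFunc C) : f′ = ratDeriv f := rfl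

end RationalFunctions

/-! ### Primitive and logarithmic towers

Throughout, `E` is a differential extension field of `K₀ = C(x)`, and `t : Fin n → E` is a list of
generators; `t j` is the generator usually written `t_{j+1}`. -/

section Towers

variable (C : Type*) [Field C] {E : Type*} [Field E] [Algebra C E] [Algebra (RatFunc C) E]

/-- The field `K_i = K₀(t_1, …, t_i)`. -/
def towerField {n : ℕ} (t : Fin n → E) (i : ℕ) : IntermediateField (RatFunc C) E :=
  IntermediateField.adjoin (RatFunc C) (t '' {j | (j : ℕ) < i})

/-- `s` is a primitive generator over the differential subfield `K`: its derivative lies in `K`,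
it is transcendental over `K`, and every constant of `K(s)` is a constant of `K`. -/
structure IsPrimitiveGenerator [Differential E] (K : IntermediateField (RatFunc C) E) (s : E) :
    Prop where
  deriv_mem : s′ ∈ K
  transcendental : Transcendental K s
  constants : ∀ f ∈ IntermediateField.adjoin K {s}, f′ = 0 → f ∈ K

/-- `s` is a logarithmic generator over `K`: a primitive generator whose derivative is a
`C`-linear combination of logarithmic derivatives `g′ / g` of elements of `K`. -/
structure IsLogarithmicGenerator [Differential E] (K : IntermediateField (RatFunc C) E) (s : E) :
    Prop extends IsPrimitiveGenerator C K s where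
  deriv_mem_span :
    s′ ∈ Submodule.span C {h : E | ∃ g ∈ K, g ≠ 0 ∧ h = Differential.logDeriv g}

/-- `E = K₀(t_1, …, t_n)` is a logarithmic tower: every `t_i` is a logarithmic generator over
`K_{i-1}`. -/
structure IsLogarithmicTower [Differential E] {n : ℕ} (t : Fin n → E) : Prop where
  generates : towerField C t n = ⊤
  generator : ∀ j : Fin n, IsLogarithmicGenerator C (towerField C t j) (t j)

/-! ### The matryoshka decomposition `K_n = P_0 ⊕ P_1 ⊕ ⋯ ⊕ P_n` -/

/-- `a` is `t_{j+1}`-proper (with `t j` written `t_{j+1}`): it is a quotient of polynomials in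
`t j` over the field generated by the previous generators, with the degree of the numerator lower
than the degree of the denominator. Zero is proper. -/
def IsProperAt {n : ℕ} (t : Fin n → E) (j : Fin n) (a : E) : Prop :=
  ∃ p q : Polynomial (towerField C t j), q ≠ 0 ∧ p.degree < q.degree ∧
    a = Polynomial.aeval (t j) p / Polynomial.aeval (t j) q

/-- The additive groups `P_0, …, P_n`: `P_0 = K₀[t_1, …, t_n]`, and for `i ≥ 1`, `P_i` consists of
the linear combinations of monomials in `t_{i+1}, …, t_n` with `t_i`-proper coefficients. -/
def matryoshka {n : ℕ} (t : Fin n → E) : Fin (n + 1) → AddSubgroup E :=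
  Fin.cases (Algebra.adjoin (RatFunc C) (Set.range t)).toSubring.toAddSubgroup
    (fun j => AddSubgroup.closure
      {f : E | ∃ a m : E, IsProperAt C t j a ∧ m ∈ Submonoid.closure (t '' {k | j < k}) ∧
        f = a * m})

/-- `g` is the family of components of `f` in the matryoshka decomposition. -/
def IsMatryoshkaDecomposition {n : ℕ} (t : Fin n → E) (f : E) (g : Fin (n + 1) → E) : Prop :=
  (∀ i, g i ∈ matryoshka C t i) ∧ ∑ i, g i = f

open scoped Classical in
/-- The `i`-th projection `π_i(f)`. In a tower of transcendental generators every element of `K_n`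
has exactly one matryoshka decomposition, so that the choice below is forced; the value `0` in the
other case is never used. -/
def proj {n : ℕ} (t : Fin n → E) (i : Fin (n + 1)) (f : E) : E :=
  if h : ∃ g, IsMatryoshkaDecomposition C t f g then h.choose i else 0

open scoped Classical in
/-- The significant index `max {i | π_i(f) ≠ 0}` of a nonzero `f`. -/
def significantIndex {n : ℕ} (t : Fin n → E) (f : E) : Fin (n + 1) :=
  (Finset.univ.filter fun i => proj C t i f ≠ 0).sup id

/-- The significant vector of the tower. -/
def significantVector [Differential E] {n : ℕ} (t : Fin n → E) (j : Fin n) : Fin (n + 1) :=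
  significantIndex C t (t j)′

/-- The significant component sequence of the tower. -/
def significantComponent [Differential E] {n : ℕ} (t : Fin n → E) (j : Fin n) : E :=
  proj C t (significantVector C t j) (t j)′

/-- The `n × n` matrix associated to the tower: rows `P_0, …, P_{n-1}`, columns
`t_1′, …, t_n′`. -/
def associatedMatrix [Differential E] {n : ℕ} (t : Fin n → E) : Matrix (Fin n) (Fin n) E :=
  Matrix.of fun i j => proj C t i.castSucc (t j)′

/-- A well-generated logarithmic tower. -/
structure IsWellGenerated [Differential E] {n : ℕ} (t : Fin n → E) : Prop
    extends IsLogarithmicTower C t where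
  linearIndependent : LinearIndependent C (significantComponent C t)
  monotone : Monotone (significantVector C t)
  existsUnique_ne_zero : ∀ j, ∃! i, associatedMatrix C t i j ≠ 0

end Towers

end LogTower

end

/-! A logarithmic derivative over a tower splits into rows: row `0` uses elements of `C(x)`, and row
`l.succ` uses polynomials monic in the generator with index `l`. A derivative of a generator is thus
a finite sum of row entries. In a well-generated tower it must consist of a single entry, so the
plan is to integrate the entries separately. `exists_antiderivatives_extension` adjoins
antiderivatives of all entries without new constants, and in each row only the pivots, the entries
outside the `C`-span of the earlier ones, are kept. Their antiderivatives `u`, listed row by row,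
are the new generators.

The rows refer to the old generators and must turn into rows of the new tower. This works if each
old generator is a single `u` plus an element of the field before that `u`, which requires the
highest entry of every column to be a pivot and these pivots to appear in column order. Hence `t` is
first replaced by a basis `s` of its `C`-span, chosen greedily so that each derivative needs as
small a field as possible (`exists_flag`). Minimality makes the leading entries independent
(`IsPartialFlag.leading_notMem`) and their rows weakly increasing.

That `u` is a logarithmic tower rests on `eq_linear_of_deriv_eq`: if the derivative of an element of
`M(s)` is an element of `M` plus logarithmic derivatives of monic polynomials in `s`, then the
logarithmic part vanishes and the element is `c * s + g` with `c` constant. By induction,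
`IsRowTower.coeff_eq_zero` shows that no derivative of a generator is integrable too early.
Directness of the matryoshka decomposition then yields well-generatedness. The `n` leading pivots
give the lower bound for `w`; the upper one holds because column `j` has at most `j + 1` nonzero
entries. -/

noncomputable section

set_option linter.unusedSectionVars false

namespace LogTower

/-! ### Simple poles and proper fractions -/

section Fractions

open Polynomial

variable {M Ω : Type*} [Field M] [Field Ω] [Algebra M Ω]

/-- Fractions in `s` with at most a simple pole at `π`. -/
def simplePoleAt (s : Ω) (π : M[X]) (hπ : Irreducible π) :
    Submodule M Ω where
  carrier := {y | ∃ c d : M[X], ¬ π ∣ d ∧ y * aeval s (π * d) = aeval s c}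
  zero_mem' := ⟨0, 1, hπ.not_dvd_one, by simp⟩
  add_mem' := by
    rintro y₁ y₂ ⟨c₁, d₁, h₁, e₁⟩ ⟨c₂, d₂, h₂, e₂⟩
    refine ⟨c₁ * d₂ + c₂ * d₁, d₁ * d₂, fun h => (hπ.prime.dvd_or_dvd h).elim h₁ h₂, ?_⟩
    simp only [map_mul, map_add] at *
    linear_combination aeval s d₂ * e₁ + aeval s d₁ * e₂
  smul_mem' := by
    rintro a y ⟨c, d, h, e⟩
    refine ⟨C a * c, d, h, ?_⟩
    rw [smul_mul_assoc, e, map_mul, aeval_C, Algebra.smul_def]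

/-- Fractions in `s` whose numerator has lower degree than the denominator. -/
def properFractions {s : Ω} (hs : Transcendental M s) : Submodule M Ω where
  carrier := {y | ∃ p q : M[X], q ≠ 0 ∧ p.degree < q.degree ∧ y = aeval s p / aeval s q}
  zero_mem' := ⟨0, 1, one_ne_zero, by simp, by simp⟩
  add_mem' := by
    rintro y₁ y₂ ⟨c₁, d₁, h₁, l₁, e₁⟩ ⟨c₂, d₂, h₂, l₂, e₂⟩
    have n₁ : aeval s d₁ ≠ 0 := fun h => h₁ ((transcendental_iff.mp hs) _ h)
    have n₂ : aeval s d₂ ≠ 0 := fun h => h₂ ((transcendental_iff.mp hs) _ h)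
    refine ⟨c₁ * d₂ + c₂ * d₁, d₁ * d₂, mul_ne_zero h₁ h₂, ?_, ?_⟩
    · refine (degree_add_le _ _).trans_lt (max_lt ?_ ?_)
      · rw [degree_mul, degree_mul]
        exact WithBot.add_lt_add_right (by simpa using h₂) l₁
      · rw [degree_mul, degree_mul, add_comm]
        exact WithBot.add_lt_add_left (by simpa using h₁) l₂
    · rw [e₁, e₂]
      simp only [map_mul, map_add]
      field_simp
  smul_mem' := by
    rintro a y ⟨c, d, h, l, e⟩
    refine ⟨C a * c, d, h, ?_, ?_⟩
    · refine lt_of_le_of_lt ?_ l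
      rw [degree_mul]
      by_cases ha : a = 0
      · simp [ha]
      · simp [degree_C ha]
    · rw [e, map_mul, aeval_C, Algebra.smul_def, mul_div_assoc]

end Fractions

/-! ### Integration in a simple primitive extension -/

section SimpleExtension

open Polynomial Differential

variable {M : Type*} [Field M] [Differential M]

/-- The derivation of `M[X]` with `X′ = r` that extends the derivation of `M`. -/
def polyDeriv (r : M) : Derivation ℤ M[X] M[X] := implicitDeriv (C r)

theorem coeff_polyDeriv (r : M) (p : M[X]) (n : ℕ) :
    (polyDeriv r p).coeff n = (p.coeff n)′ + r * (p.coeff (n + 1) * (n + 1)) := by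
  simp [polyDeriv, implicitDeriv, coeff_derivative]

theorem degree_polyDeriv_lt {r : M} {p : M[X]} (hp : p.Monic) (h0 : p ≠ 1) :
    (polyDeriv r p).degree < p.degree := by
  have hd : 0 < p.natDegree := by
    rcases Nat.eq_zero_or_pos p.natDegree with h | h
    · exact absurd (hp.natDegree_eq_zero.mp h) h0
    · exact h
  rw [degree_eq_natDegree hp.ne_zero, degree_lt_iff_coeff_zero]
  intro m hm
  rw [coeff_polyDeriv, coeff_eq_zero_of_natDegree_lt (by omega : p.natDegree < m + 1)]
  rcases hm.eq_or_lt with h | h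
  · rw [← h, hp.coeff_natDegree]; simp
  · rw [coeff_eq_zero_of_natDegree_lt h]; simp

variable [CharZero M]

/-- If `p` is monic of degree `d`, the coefficient of degree `d - 1` in its derivative is `(p.coeff
(d - 1))′ + d * r`. Its vanishing would make `r` the derivative of `-p.coeff (d - 1) / d`. -/
theorem polyDeriv_ne_zero {r : M} (hr : ∀ g : M, g′ ≠ r) {p : M[X]} (hp : p.Monic)
    (h0 : p ≠ 1) : polyDeriv r p ≠ 0 := by
  intro h
  have hd : 0 < p.natDegree := by
    rcases Nat.eq_zero_or_pos p.natDegree with h | h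
    · exact absurd (hp.natDegree_eq_zero.mp h) h0
    · exact h
  have h1 := coeff_polyDeriv r p (p.natDegree - 1)
  have h2 : p.natDegree - 1 + 1 = p.natDegree := by omega
  rw [h, coeff_zero, h2, hp.coeff_natDegree] at h1
  have h3 : ((p.natDegree - 1 : ℕ) : M) + 1 = (p.natDegree : M) := by
    rw [← Nat.cast_add_one, h2]
  rw [h3] at h1
  have hne : (p.natDegree : M) ≠ 0 := by exact_mod_cast hd.ne'
  have hc : ((p.natDegree : M))′ = 0 := by simp
  apply hr (-(p.coeff (p.natDegree - 1)) / p.natDegree)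
  rw [Derivation.leibniz_div_const _ _ _ hc, smul_eq_mul, map_neg]
  field_simp
  linear_combination h1

variable {Ω : Type*} [Field Ω] [Differential Ω] [Algebra M Ω] [DifferentialAlgebra M Ω]

omit [CharZero M] in
theorem deriv_aeval_eq_polyDeriv {r : M} {s : Ω} (hs : s′ = algebraMap M Ω r) (p : M[X]) :
    (aeval s p)′ = aeval s (polyDeriv r p) :=
  deriv_aeval_eq_implicitDeriv s (C r) (by simpa using hs) p

/-- An element whose derivative has no antiderivative in the base field is transcendental. -/
theorem transcendental_of_not_integrable {r : M} (hr : ∀ g : M, g′ ≠ r) {s : Ω}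
    (hs : s′ = algebraMap M Ω r) : Transcendental M s := by
  intro halg
  have hint := halg.isIntegral
  have hm := minpoly.monic hint
  have h1 : minpoly M s ≠ 1 := minpoly.ne_one M s
  have h := deriv_aeval_eq_polyDeriv hs (minpoly M s)
  rw [minpoly.aeval, map_zero] at h
  -- The derivative of the minimal polynomial also annihilates `s`; it is nonzero and has smaller
  -- degree.
  exact absurd (minpoly.degree_le_of_ne_zero M s (polyDeriv_ne_zero hr hm h1) h.symm)
    (not_le.mpr (degree_polyDeriv_lt hm h1))

variable (M) in
/-- The linear combinations of logarithmic derivatives of monic polynomials in `s`. -/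
def monicLogDerivSpan (s : Ω) : Submodule M Ω :=
  Submodule.span M {h | ∃ p : M[X], p.Monic ∧ h = Differential.logDeriv (aeval s p)}

omit [CharZero M] in
theorem monicLogDerivSpan_le_properFractions {r : M} {s : Ω} (hs' : s′ = algebraMap M Ω r)
    (hs : Transcendental M s) : monicLogDerivSpan M s ≤ properFractions hs := by
  refine Submodule.span_le.mpr ?_
  rintro _ ⟨p, hp, rfl⟩
  by_cases h1 : p = 1
  · subst h1; simp
  · exact ⟨polyDeriv r p, p, hp.ne_zero, degree_polyDeriv_lt hp h1,
      by rw [Differential.logDeriv, deriv_aeval_eq_polyDeriv hs']⟩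

-- With `p = π ^ m * q` and `π` not dividing `q`, the logarithmic derivative is `m π′/π + q′/q`,
-- whatever the multiplicity `m`.
omit [CharZero M] in
theorem monicLogDerivSpan_le_simplePoleAt {r : M} {s : Ω} (hs' : s′ = algebraMap M Ω r)
    (hs : Transcendental M s) (π : M[X]) (hπ : Irreducible π) :
    monicLogDerivSpan M s ≤ simplePoleAt s π hπ := by
  refine Submodule.span_le.mpr ?_
  rintro _ ⟨p, hp, rfl⟩
  obtain ⟨m, q, hq, rfl⟩ := WfDvdMonoid.max_power_factor hp.ne_zero hπ
  have hq0 : q ≠ 0 := by rintro rfl; simp at hq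
  have nq : aeval s q ≠ 0 := fun h => hq0 ((transcendental_iff.mp hs) _ h)
  have nπ : aeval s π ≠ 0 := fun h => hπ.ne_zero ((transcendental_iff.mp hs) _ h)
  refine ⟨m * polyDeriv r π * q + π * polyDeriv r q, q, hq, ?_⟩
  rw [map_mul, map_pow, logDeriv_mul _ _ (pow_ne_zero _ nπ) nq, Differential.logDeriv_pow, Differential.logDeriv, Differential.logDeriv,
    deriv_aeval_eq_polyDeriv hs', deriv_aeval_eq_polyDeriv hs']
  simp only [map_mul, map_add, map_natCast]
  field_simp

/-- If the derivative of a fraction `f` in `s` is the sum of an element of the base field and a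
combination of logarithmic derivatives, then `f` is a polynomial in `s`. -/
theorem eq_aeval_of_deriv_eq {r : M} (hr : ∀ g : M, g′ ≠ r) {s : Ω} (hs' : s′ = algebraMap M Ω r)
    (a b : M[X]) {A : M} {y : Ω} (hy : y ∈ monicLogDerivSpan M s)
    (hf : (aeval s a / aeval s b)′ = algebraMap M Ω A + y) :
    ∃ p : M[X], aeval s a / aeval s b = aeval s p := by
  have hs := transcendental_of_not_integrable hr hs'
  have inj := transcendental_iff_injective.mp hs
  by_cases hb : b = 0
  · exact ⟨0, by simp [hb]⟩
  classical
  wlog hcop : IsCoprime a b generalizing a b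
  · have hg : EuclideanDomain.gcd a b ≠ 0 := fun h => hb (EuclideanDomain.gcd_eq_zero_iff.mp h).2
    obtain ⟨a', ha'⟩ := EuclideanDomain.gcd_dvd_left a b
    obtain ⟨b', hb'⟩ := EuclideanDomain.gcd_dvd_right a b
    have e : aeval s a / aeval s b = aeval s a' / aeval s b' := by
      rw [congrArg (aeval s) ha', congrArg (aeval s) hb']
      rw [map_mul, map_mul, mul_div_mul_left]
      exact fun h => hg ((transcendental_iff.mp hs) _ h)
    rw [e] at hf ⊢
    refine this a' b' hf ?_ ?_
    · rintro rfl; exact hb (by rw [hb', mul_zero])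
    · have h := EuclideanDomain.gcd_eq_gcd_ab a b
      generalize EuclideanDomain.gcdA a b = x at h
      generalize EuclideanDomain.gcdB a b = z at h
      refine ⟨x, z, mul_left_cancel₀ hg ?_⟩
      linear_combination -h - x * ha' - z * hb'
  by_cases hu : IsUnit b
  · obtain ⟨c, hc, rfl⟩ := isUnit_iff.mp hu
    refine ⟨a * C c⁻¹, ?_⟩
    simp [div_eq_mul_inv]
  exfalso
  obtain ⟨π, hπm, hπ, hdvd⟩ := exists_monic_irreducible_factor b hu
  obtain ⟨m, b₁, hb₁, hbe⟩ := WfDvdMonoid.max_power_factor hb hπ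
  have hm : m ≠ 0 := by rintro rfl; exact hb₁ (by simpa [hbe] using hdvd)
  -- From here on the multiplicity of `π` in `b` is `m + 1`. Differentiation would raise the pole
  -- order to `m + 2`, at least `2`, whereas the right-hand side has at most a simple pole.
  obtain ⟨m, rfl⟩ := Nat.exists_eq_succ_of_ne_zero hm
  have hπa : ¬ π ∣ a := fun h => hπ.not_isUnit (hcop.isUnit_of_dvd' h hdvd)
  have hmem : (aeval s a / aeval s b)′ ∈ simplePoleAt s π hπ := by
    rw [hf]
    refine add_mem ⟨C A * π, 1, hπ.not_dvd_one, by simp⟩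
      (monicLogDerivSpan_le_simplePoleAt hs' hs π hπ hy)
  obtain ⟨c, d, hd, e⟩ := hmem
  have nb : aeval s b ≠ 0 := fun h => hb ((transcendental_iff.mp hs) _ h)
  set D := polyDeriv r with hD
  have e1 : (D a * b - a * D b) * (π * d) = c * b ^ 2 := by
    apply inj
    rw [Derivation.leibniz_div, deriv_aeval_eq_polyDeriv hs',
      deriv_aeval_eq_polyDeriv hs', smul_eq_mul, smul_eq_mul, smul_eq_mul] at e
    rw [map_mul (aeval s) c, ← e]
    simp only [map_mul, map_sub, map_pow]
    field_simp
    ring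
  have e2 : D b = (m + 1) * π ^ m * D π * b₁ + π ^ (m + 1) * D b₁ := by
    rw [hbe, Derivation.leibniz, Derivation.leibniz_pow]
    simp only [smul_eq_mul, nsmul_eq_mul, Nat.succ_eq_add_one, Nat.add_sub_cancel]
    push_cast
    ring
  have e3 : π ^ (m + 1) * ((D a * π * b₁ - a * ((m + 1) * D π * b₁ + π * D b₁)) * d) =
      π ^ (m + 1) * (π * (c * π ^ m * b₁ ^ 2)) := by
    rw [e2, hbe] at e1
    simp only [Nat.succ_eq_add_one] at e1
    linear_combination e1
  have e4 := mul_left_cancel₀ (pow_ne_zero _ hπ.ne_zero) e3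
  -- Modulo `π` only the term coming from differentiating `π ^ (m + 1)` survives; none of its
  -- factors is divisible by `π`.
  have e5 : π ∣ (a * b₁ * d * D π) * ((m + 1 : ℕ) : M[X]) :=
    ⟨D a * b₁ * d - a * D b₁ * d - c * π ^ m * b₁ ^ 2, by push_cast; linear_combination -e4⟩
  have h1 : π ≠ 1 := fun h => hπ.not_isUnit (h ▸ isUnit_one)
  have hDπ : ¬ π ∣ D π := fun h =>
    not_dvd_of_degree_lt (polyDeriv_ne_zero hr hπm h1) (degree_polyDeriv_lt hπm h1) h
  have hp := hπ.prime
  rcases hp.dvd_or_dvd e5 with h | h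
  · rcases hp.dvd_or_dvd h with h | h
    · rcases hp.dvd_or_dvd h with h | h
      · exact (hp.dvd_or_dvd h).elim hπa hb₁
      · exact hd h
    · exact hDπ h
  · refine hπ.not_isUnit (isUnit_of_dvd_unit h ?_)
    rw [← C_eq_natCast, isUnit_C]
    exact (Nat.cast_ne_zero.mpr (Nat.succ_ne_zero m)).isUnit

/-- The integrability criterion in a simple primitive extension. -/
theorem eq_linear_of_deriv_eq {r : M} (hr : ∀ g : M, g′ ≠ r) {s : Ω} (hs' : s′ = algebraMap M Ω r)
    (a b : M[X]) {A : M} {y : Ω} (hy : y ∈ monicLogDerivSpan M s)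
    (hf : (aeval s a / aeval s b)′ = algebraMap M Ω A + y) :
    y = 0 ∧ ∃ c g : M, c′ = 0 ∧
      aeval s a / aeval s b = algebraMap M Ω c * s + algebraMap M Ω g := by
  have hs := transcendental_of_not_integrable hr hs'
  have inj := transcendental_iff_injective.mp hs
  obtain ⟨p, hp⟩ := eq_aeval_of_deriv_eq hr hs' a b hy hf
  obtain ⟨N, Q, hQ, hdeg, hyN⟩ := monicLogDerivSpan_le_properFractions hs' hs hy
  have nQ : aeval s Q ≠ 0 := fun h => hQ ((transcendental_iff.mp hs) _ h)
  rw [hp, deriv_aeval_eq_polyDeriv hs', hyN] at hf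
  have e1 : (polyDeriv r p - C A) * Q = N := by
    apply inj
    simp only [map_mul, map_sub, aeval_C, hf]
    field_simp
    ring
  -- This polynomial equals a proper fraction, so it is zero.
  have e2 : polyDeriv r p - C A = 0 := by
    by_contra h
    rw [← e1, degree_mul] at hdeg
    have : Q.degree ≤ (polyDeriv r p - C A).degree + Q.degree := by
      have := add_le_add_left (zero_le_degree_iff.mpr h) Q.degree
      simpa using this
    exact absurd hdeg (not_lt.mpr this)
  have hN : N = 0 := by rw [← e1, e2, zero_mul]
  refine ⟨by simp [hyN, hN], ?_⟩
  have e3 : ∀ n, 1 ≤ n → (p.coeff n)′ + r * (p.coeff (n + 1) * (n + 1)) = 0 := by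
    intro n hn
    rw [← coeff_polyDeriv, sub_eq_zero.mp e2, coeff_C, if_neg (by omega)]
  -- If the degree were `k + 1` with `k ≥ 1`, the leading coefficient would be a constant and the
  -- next coefficient equation would integrate `r` in `M`.
  have hd : p.natDegree ≤ 1 := by
    by_contra hd
    push Not at hd
    obtain ⟨k, hk⟩ : ∃ k, p.natDegree = k + 1 := ⟨p.natDegree - 1, by omega⟩
    have h1 := e3 (k + 1) (by omega)
    rw [coeff_eq_zero_of_natDegree_lt (by omega : p.natDegree < k + 1 + 1)] at h1
    simp only [zero_mul, mul_zero, add_zero] at h1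
    have h2 := e3 k (by omega)
    have hl : p.coeff (k + 1) ≠ 0 := by
      rw [← hk]; exact leadingCoeff_ne_zero.mpr (by rintro rfl; simp at hk)
    have hne : ((k : M) + 1) ≠ 0 := by exact_mod_cast Nat.succ_ne_zero k
    have hc : (p.coeff (k + 1) * ((k : M) + 1))′ = 0 := by
      simp [Derivation.leibniz, h1]
    apply hr (-(p.coeff k) / (p.coeff (k + 1) * (k + 1)))
    rw [Derivation.leibniz_div_const _ _ _ hc, smul_eq_mul, map_neg]
    field_simp
    linear_combination -h2
  refine ⟨p.coeff 1, p.coeff 0, ?_, ?_⟩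
  · have h1 := e3 1 le_rfl
    rw [coeff_eq_zero_of_natDegree_lt (by omega : p.natDegree < 1 + 1)] at h1
    simpa using h1
  · rw [hp]
    conv_lhs => rw [eq_X_add_C_of_natDegree_le_one hd]
    simp

end SimpleExtension

/-! ### Derivations on fraction fields -/

section FractionField

variable {A : Type*} [CommRing A] [IsDomain A] (D : Derivation ℤ A A)
  {K : Type*} [Field K] [Algebra A K] [IsFractionRing A K]

/-- The extension of a derivation to the fraction field by the quotient rule. -/
def fractionDeriv (f : K) : K :=
  (algebraMap A K (D (IsFractionRing.div_surjective (A := A) f).choose) *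
      algebraMap A K (IsFractionRing.div_surjective (A := A) f).choose_spec.choose -
    algebraMap A K (IsFractionRing.div_surjective (A := A) f).choose *
      algebraMap A K (D (IsFractionRing.div_surjective (A := A) f).choose_spec.choose)) /
    algebraMap A K (IsFractionRing.div_surjective (A := A) f).choose_spec.choose ^ 2

/-- The choice of representative does not matter: differentiate the cross-multiplied identity `n * q
= p * d`. -/
theorem fractionDeriv_div (p q : A) (hq : q ≠ 0) :
    fractionDeriv D (algebraMap A K p / algebraMap A K q) =
      (algebraMap A K (D p) * algebraMap A K q - algebraMap A K p * algebraMap A K (D q)) /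
        algebraMap A K q ^ 2 := by
  set f : K := algebraMap A K p / algebraMap A K q with hf
  have hspec := (IsFractionRing.div_surjective (A := A) f).choose_spec.choose_spec
  rw [fractionDeriv]
  generalize (IsFractionRing.div_surjective (A := A) f).choose_spec.choose = d at *
  generalize (IsFractionRing.div_surjective (A := A) f).choose = n at *
  obtain ⟨hd, he⟩ := hspec
  have hd' : algebraMap A K d ≠ 0 := IsFractionRing.to_map_ne_zero_of_mem_nonZeroDivisors hd
  have hq' : algebraMap A K q ≠ 0 := by simpa using hq
  have h0 : algebraMap A K n * algebraMap A K q = algebraMap A K p * algebraMap A K d := by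
    rwa [hf, div_eq_div_iff hd' hq'] at he
  have h1 : n * q = p * d := IsFractionRing.injective A K (by simpa using h0)
  have h2 := congrArg (fun r => algebraMap A K (D r)) h1
  simp only [Derivation.leibniz, smul_eq_mul, map_add, map_mul] at h2
  rw [div_eq_div_iff (pow_ne_zero 2 hd') (pow_ne_zero 2 hq')]
  linear_combination (algebraMap A K q * algebraMap A K d) * h2 -
    (algebraMap A K q * algebraMap A K (D d) + algebraMap A K d * algebraMap A K (D q)) * h0

/-- The fraction field of a differential domain as a differential field. -/
@[reducible]
def fractionDifferential : Differential K :=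
  differentialOf (fractionDeriv D)
    (by
      intro a b
      obtain ⟨p, q, hq, rfl⟩ := IsFractionRing.div_surjective (A := A) a
      obtain ⟨r, s, hs, rfl⟩ := IsFractionRing.div_surjective (A := A) b
      have hq' : algebraMap A K q ≠ 0 := IsFractionRing.to_map_ne_zero_of_mem_nonZeroDivisors hq
      have hs' : algebraMap A K s ≠ 0 := IsFractionRing.to_map_ne_zero_of_mem_nonZeroDivisors hs
      have e : algebraMap A K p / algebraMap A K q + algebraMap A K r / algebraMap A K s =
          algebraMap A K (p * s + q * r) / algebraMap A K (q * s) := by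
        simp only [map_add, map_mul]
        rw [div_add_div _ _ hq' hs']
      have hq0 := nonZeroDivisors.ne_zero hq
      have hs0 := nonZeroDivisors.ne_zero hs
      rw [e, fractionDeriv_div _ _ _ (mul_ne_zero hq0 hs0), fractionDeriv_div _ _ _ hq0,
        fractionDeriv_div _ _ _ hs0]
      simp only [Derivation.leibniz, smul_eq_mul, map_add, map_mul]
      field_simp
      ring)
    (by
      intro a b
      obtain ⟨p, q, hq, rfl⟩ := IsFractionRing.div_surjective (A := A) a
      obtain ⟨r, s, hs, rfl⟩ := IsFractionRing.div_surjective (A := A) b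
      have hq' : algebraMap A K q ≠ 0 := IsFractionRing.to_map_ne_zero_of_mem_nonZeroDivisors hq
      have hs' : algebraMap A K s ≠ 0 := IsFractionRing.to_map_ne_zero_of_mem_nonZeroDivisors hs
      have e : algebraMap A K p / algebraMap A K q * (algebraMap A K r / algebraMap A K s) =
          algebraMap A K (p * r) / algebraMap A K (q * s) := by
        simp only [map_mul]
        rw [div_mul_div_comm]
      have hq0 := nonZeroDivisors.ne_zero hq
      have hs0 := nonZeroDivisors.ne_zero hs
      rw [e, fractionDeriv_div _ _ _ (mul_ne_zero hq0 hs0), fractionDeriv_div _ _ _ hq0,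
        fractionDeriv_div _ _ _ hs0]
      simp only [Derivation.leibniz, smul_eq_mul, map_add, map_mul]
      field_simp
      ring)

theorem fractionDifferential_algebraMap (a : A) :
    letI : Differential K := fractionDifferential D
    (algebraMap A K a)′ = algebraMap A K (D a) := by
  change fractionDeriv D _ = _
  have := fractionDeriv_div D (K := K) a 1 one_ne_zero
  simpa using this

end FractionField

/-! ### Adjoining antiderivatives -/

section Antiderivatives

open Polynomial in
/-- Adjoining an antiderivative without new constants. -/
theorem exists_antiderivative_extension {K : Type u} [Field K] [CharZero K] [Differential K]
    (a : K) :
    ∃ (L : Type u) (_ : Field L) (_ : Differential L) (ι : K →+* L),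
      (∀ x, ι x′ = (ι x)′) ∧ (∀ y : L, y′ = 0 → y ∈ Set.range ι) ∧
        ∃ z : L, z′ = ι a ∧ ∀ S : Subfield L, Set.range ι ⊆ S → z ∈ S → S = ⊤ := by
  by_cases ha : ∃ g : K, g′ = a
  · obtain ⟨g, hg⟩ := ha
    refine ⟨K, _, ‹_›, RingHom.id K, fun _ => rfl, fun y _ => ⟨y, rfl⟩, g, hg, fun S hS _ => ?_⟩
    exact eq_top_iff.mpr fun x _ => hS ⟨x, rfl⟩
  push Not at ha
  let _ : Differential (FractionRing K[X]) := fractionDifferential (polyDeriv a)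
  have hX : ∀ p : K[X], (algebraMap K[X] (FractionRing K[X]) p)′ =
      algebraMap K[X] (FractionRing K[X]) (polyDeriv a p) :=
    fractionDifferential_algebraMap (polyDeriv a)
  have hC : ∀ c : K, algebraMap K (FractionRing K[X]) c =
      algebraMap K[X] (FractionRing K[X]) (C c) := fun c =>
    IsScalarTower.algebraMap_apply K K[X] (FractionRing K[X]) c
  have : DifferentialAlgebra K (FractionRing K[X]) := ⟨fun c => by
    rw [hC, hX, hC]; simp [polyDeriv]⟩
  set z := algebraMap K[X] (FractionRing K[X]) X with hz
  have hz' : z′ = algebraMap K (FractionRing K[X]) a := by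
    rw [hz, hX, hC]; simp [polyDeriv]
  have haev : ∀ p : K[X], algebraMap K[X] (FractionRing K[X]) p = aeval z p := fun p => by
    rw [hz, aeval_algebraMap_apply, aeval_X_left_apply]
  refine ⟨FractionRing K[X], _, ‹_›, algebraMap K _, fun x => (deriv_algebraMap x).symm, ?_, z,
    hz', ?_⟩
  · intro y hy
    obtain ⟨p, q, hq, rfl⟩ := IsFractionRing.div_surjective (A := K[X]) y
    rw [haev, haev] at hy ⊢
    -- A new constant must have the form `c * z + g`, so `c * a + g′ = 0`; a nonzero `c` would
    -- integrate `a` in `K`.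
    obtain ⟨-, c, g, hc, e⟩ := eq_linear_of_deriv_eq ha hz' p q (A := 0) (y := 0)
      (Submodule.zero_mem _) (by rw [hy]; simp)
    rw [e] at hy ⊢
    have h1 : algebraMap K (FractionRing K[X]) (c * a + g′) = 0 := by
      rw [← hy]
      simp [Derivation.leibniz, deriv_algebraMap, hc, hz']
    have h2 : c * a + g′ = 0 := (map_eq_zero _).mp h1
    have hc0 : c = 0 := by
      by_contra hc0
      apply ha (-g / c)
      rw [Derivation.leibniz_div_const _ _ _ hc, smul_eq_mul, map_neg]
      field_simp
      linear_combination -h2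
    exact ⟨g, by simp [hc0]⟩
  · intro S hS hzS
    refine eq_top_iff.mpr fun x _ => ?_
    obtain ⟨p, q, hq, rfl⟩ := IsFractionRing.div_surjective (A := K[X]) x
    have hmem : ∀ p : K[X], aeval z p ∈ S := by
      intro p
      induction p using Polynomial.induction_on' with
      | add p q hp hq => rw [map_add]; exact add_mem hp hq
      | monomial n c => rw [aeval_monomial]; exact mul_mem (hS ⟨c, rfl⟩) (pow_mem hzS n)
    rw [haev, haev]
    exact div_mem (hmem p) (hmem q)

/-- Adjoining antiderivatives of finitely many elements without new constants. -/
theorem exists_antiderivatives_extension {E : Type v} [Field E] [CharZero E] [Differential E]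
    [Small.{u} E] (A : Finset E) :
    ∃ (L : Type u) (_ : Field L) (_ : Differential L) (ι : E →+* L),
      (∀ x, ι x′ = (ι x)′) ∧ (∀ y : L, y′ = 0 → y ∈ Set.range ι) ∧
        (∀ a ∈ A, ∃ z : L, z′ = ι a) ∧
        ∀ S : Subfield L, Set.range ι ⊆ S → (∀ z : L, (∃ a ∈ A, z′ = ι a) → z ∈ S) → S = ⊤ := by
  classical
  induction A using Finset.induction_on with
  | empty =>
    -- Only a copy of `E` in the smaller universe is needed when nothing is adjoined.
    let _ : Differential (Shrink.{u} E) := Differential.equiv (Shrink.ringEquiv E)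
    refine ⟨Shrink.{u} E, inferInstance, ‹_›, (Shrink.ringEquiv E).symm.toRingHom, ?_, ?_, by simp,
      ?_⟩
    · intro x
      change _ = (Shrink.ringEquiv E).symm ((Shrink.ringEquiv E) ((Shrink.ringEquiv E).symm x))′
      simp
    · exact fun y _ => (Shrink.ringEquiv E).symm.surjective y
    · intro S hS _
      refine eq_top_iff.mpr fun x _ => hS ((Shrink.ringEquiv E).symm.surjective x)
  | insert a A _ ih =>
    obtain ⟨K, _, _, ι, hι, hconst, hanti, hgen⟩ := ih
    have : CharZero K := charZero_of_injective_ringHom ι.injective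
    obtain ⟨L, _, _, j, hj, hjconst, z, hz, hjgen⟩ := exists_antiderivative_extension (ι a)
    refine ⟨L, _, ‹_›, j.comp ι, fun x => ?_, fun y hy => ?_, fun b hb => ?_, fun S hS hzS => ?_⟩
    · simp [hι, hj]
    · obtain ⟨x, rfl⟩ := hjconst y hy
      rw [← hj, map_eq_zero] at hy
      obtain ⟨x, rfl⟩ := hconst x hy
      exact ⟨x, rfl⟩
    · rcases Finset.mem_insert.mp hb with rfl | hb
      · exact ⟨z, hz⟩
      · obtain ⟨y, hy⟩ := hanti b hb
        exact ⟨j y, by rw [← hj, hy]; rfl⟩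
    · apply hjgen S
      · have h : S.comap j = ⊤ := by
          apply hgen
          · rintro _ ⟨x, rfl⟩
            exact hS ⟨x, rfl⟩
          · rintro y ⟨b, hb, hy⟩
            exact hzS _ ⟨b, Finset.mem_insert_of_mem hb, by rw [← hj, hy]; rfl⟩
        rintro _ ⟨x, rfl⟩
        have : x ∈ S.comap j := h ▸ Subfield.mem_top x
        exact this
      · exact hzS z ⟨a, Finset.mem_insert_self _ _, hz⟩

end Antiderivatives

/-! ### The fields of a tower -/

section Basics

open Polynomial

variable {C : Type*} [Field C] {E : Type*} [Field E] [Algebra C E] [Algebra (RatFunc C) E]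
  [IsScalarTower C (RatFunc C) E]

theorem algebraMap_mem_intermediateField (K : IntermediateField (RatFunc C) E) (c : C) :
    algebraMap C E c ∈ K := by
  rw [IsScalarTower.algebraMap_apply C (RatFunc C) E]
  exact K.algebraMap_mem _

theorem smul_mem_intermediateField (K : IntermediateField (RatFunc C) E) (c : C) {x : E}
    (hx : x ∈ K) : c • x ∈ K := by
  rw [Algebra.smul_def]
  exact mul_mem (algebraMap_mem_intermediateField K c) hx

/-- An intermediate field as a space over the constants. -/
def constSubmodule (K : IntermediateField (RatFunc C) E) : Submodule C E where
  carrier := K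
  zero_mem' := K.zero_mem
  add_mem' := K.add_mem
  smul_mem' := fun c _ hx => smul_mem_intermediateField K c hx

theorem mem_constSubmodule {K : IntermediateField (RatFunc C) E} {x : E} :
    x ∈ constSubmodule K ↔ x ∈ K := Iff.rfl

theorem towerField_mono {n : ℕ} (t : Fin n → E) {a b : ℕ} (h : a ≤ b) :
    towerField C t a ≤ towerField C t b :=
  IntermediateField.adjoin.mono _ _ _ (Set.image_mono fun _ hj => lt_of_lt_of_le hj h)

theorem mem_towerField {n : ℕ} (t : Fin n → E) {j : Fin n} {b : ℕ} (h : (j : ℕ) < b) :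
    t j ∈ towerField C t b :=
  IntermediateField.subset_adjoin _ _ ⟨j, h, rfl⟩

theorem towerField_zero {n : ℕ} (t : Fin n → E) : towerField C t 0 = ⊥ := by
  simp [towerField]

theorem towerField_le_iff {n : ℕ} (t : Fin n → E) {b : ℕ} {K : IntermediateField (RatFunc C) E} :
    towerField C t b ≤ K ↔ ∀ j : Fin n, (j : ℕ) < b → t j ∈ K := by
  rw [towerField, IntermediateField.adjoin_le_iff, Set.image_subset_iff]
  rfl

theorem mem_towerField_succ {n : ℕ} (t : Fin n → E) (l : Fin n) {x : E} :
    x ∈ towerField C t (l + 1) ↔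
      x ∈ IntermediateField.adjoin (towerField C t l) ({t l} : Set E) := by
  have h : (IntermediateField.adjoin (towerField C t l) ({t l} : Set E)).restrictScalars
      (RatFunc C) = towerField C t (l + 1) := by
    rw [towerField, IntermediateField.adjoin_adjoin_left, towerField]
    congr 1
    ext y
    simp only [Set.mem_union, Set.mem_image, Set.mem_ofPred_eq, Set.mem_singleton_iff]
    constructor
    · rintro (⟨j, hj, rfl⟩ | rfl)
      · exact ⟨j, by omega, rfl⟩
      · exact ⟨l, by omega, rfl⟩
    · rintro ⟨j, hj, rfl⟩
      rcases (Nat.lt_succ_iff.mp hj).lt_or_eq with h | h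
      · exact Or.inl ⟨j, h, rfl⟩
      · exact Or.inr (by rw [Fin.ext h])
  rw [← h]
  rfl

theorem exists_fraction_of_mem_towerField_succ {n : ℕ} (t : Fin n → E) (l : Fin n) {x : E}
    (hx : x ∈ towerField C t (l + 1)) :
    ∃ p q : (towerField C t l)[X], x = aeval (t l) p / aeval (t l) q :=
  (IntermediateField.mem_adjoin_simple_iff _ x).mp ((mem_towerField_succ t l).mp hx)

/-- A `C`-linear combination of elements that are transcendental over the preceding ones lies in
`K₀` only if it is trivial. -/
theorem eq_zero_of_sum_smul_mem {n : ℕ} {t : Fin n → E}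
    (ht : ∀ j : Fin n, t j ∉ towerField C t j) (c : Fin n → C) (h : ∑ i, c i • t i ∈ towerField C t 0) :
    c = 0 := by
  classical
  by_contra hc
  obtain ⟨i₀, hi₀⟩ := Function.ne_iff.mp hc
  have hne : (Finset.univ.filter fun i => c i ≠ 0).Nonempty := ⟨i₀, by simpa using hi₀⟩
  obtain ⟨i, hi, hmax⟩ := Finset.exists_max_image _ id hne
  have hci : c i ≠ 0 := (Finset.mem_filter.mp hi).2
  apply ht i
  rw [← Finset.add_sum_erase _ _ (Finset.mem_univ i)] at h
  have h1 : ∑ j ∈ Finset.univ.erase i, c j • t j ∈ towerField C t i := by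
    refine sum_mem fun j hj => ?_
    by_cases hcj : c j = 0
    · rw [hcj, zero_smul]; exact zero_mem _
    · have : j ≤ i := hmax j (by simpa using hcj)
      exact smul_mem_intermediateField _ _
        (mem_towerField t (Fin.lt_def.mp (lt_of_le_of_ne this (Finset.ne_of_mem_erase hj))))
  have h2 := sub_mem (towerField_mono t (Nat.zero_le i) h) h1
  rw [add_sub_cancel_right] at h2
  simpa [smul_smul, hci] using smul_mem_intermediateField _ (c i)⁻¹ h2

end Basics

/-! ### Derivations on a tower and the row decomposition -/

section Derivations

open Polynomial

variable {C : Type*} [Field C] {E : Type*} [Field E] [Algebra C E] [Algebra (RatFunc C) E]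
  [IsScalarTower C (RatFunc C) E] [Differential E] [DifferentialAlgebra (RatFunc C) E]

theorem deriv_algebraMap_polynomial (p : C[X]) :
    (algebraMap C[X] (RatFunc C) p)′ = algebraMap C[X] (RatFunc C) (derivative p) := by
  rw [ratFunc_deriv]
  simpa using ratDeriv_div p 1 one_ne_zero

variable (E) in
theorem deriv_const (c : C) : (algebraMap C E c)′ = 0 := by
  rw [IsScalarTower.algebraMap_apply C (RatFunc C) E, deriv_algebraMap,
    IsScalarTower.algebraMap_apply C C[X] (RatFunc C), deriv_algebraMap_polynomial]
  simp

theorem deriv_smul_const (c : C) (x : E) : (c • x)′ = c • x′ := by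
  simp [Algebra.smul_def, Derivation.leibniz, deriv_const]

/-- An intermediate field closed under the derivation as a differential field. -/
@[reducible]
def intermediateDifferential (K : IntermediateField (RatFunc C) E) (hK : ∀ x ∈ K, x′ ∈ K) :
    Differential K :=
  differentialOf (fun x => ⟨(x : E)′, hK x x.2⟩) (fun a b => by ext; simp)
    (fun a b => by ext; simp [Derivation.leibniz])

theorem intermediateDifferential_algebra (K : IntermediateField (RatFunc C) E)
    (hK : ∀ x ∈ K, x′ ∈ K) :
    letI := intermediateDifferential K hK
    DifferentialAlgebra K E :=
  letI := intermediateDifferential K hK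
  ⟨fun _ => rfl⟩

theorem deriv_mem_towerField {n : ℕ} {t : Fin n → E} {m : ℕ}
    (ht : ∀ j : Fin n, (j : ℕ) < m → (t j)′ ∈ towerField C t m) :
    ∀ x ∈ towerField C t m, x′ ∈ towerField C t m := by
  intro x hx
  induction hx using IntermediateField.adjoin_induction with
  | mem x hx => obtain ⟨j, hj, rfl⟩ := hx; exact ht j hj
  | algebraMap x => rw [deriv_algebraMap]; exact IntermediateField.algebraMap_mem _ _
  | add x y _ _ h1 h2 => rw [map_add]; exact add_mem h1 h2
  | inv x hx h =>
    rw [Derivation.leibniz_inv, smul_eq_mul]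
    exact mul_mem (neg_mem (pow_mem (inv_mem hx) 2)) h
  | mul x y hx hy h1 h2 =>
    rw [Derivation.leibniz]
    exact add_mem (mul_mem hx h2) (mul_mem hy h1)

/-! ### Spaces of logarithmic derivatives -/

variable (C) in
/-- The `C`-linear combinations of logarithmic derivatives of elements of `K`. -/
def logDerivSpan (K : IntermediateField (RatFunc C) E) : Submodule C E :=
  Submodule.span C {h : E | ∃ g ∈ K, g ≠ 0 ∧ h = Differential.logDeriv g}

theorem logDerivSpan_mono {K L : IntermediateField (RatFunc C) E} (h : K ≤ L) :
    logDerivSpan C K ≤ logDerivSpan C L :=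
  Submodule.span_mono fun _ ⟨g, hg, h0, e⟩ => ⟨g, h hg, h0, e⟩

theorem logDeriv_mem_logDerivSpan {K : IntermediateField (RatFunc C) E} {g : E} (hg : g ∈ K) :
    Differential.logDeriv g ∈ logDerivSpan C K := by
  by_cases h : g = 0
  · simp [h]
  · exact Submodule.subset_span ⟨g, hg, h, rfl⟩

theorem logDerivSpan_le {K : IntermediateField (RatFunc C) E} (hK : ∀ x ∈ K, x′ ∈ K) :
    logDerivSpan C K ≤ constSubmodule K := by
  refine Submodule.span_le.mpr ?_
  rintro _ ⟨g, hg, -, rfl⟩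
  exact mem_constSubmodule.mpr (div_mem (hK g hg) hg)

variable (C) in
/-- The `C`-linear combinations of logarithmic derivatives of monic polynomials in `t_l` over the
field generated by the previous generators, and of elements of `K₀` in the first row. -/
def rowSpan {n : ℕ} (t : Fin n → E) : Fin (n + 1) → Submodule C E :=
  Fin.cases (logDerivSpan C ⊥) fun l => Submodule.span C
    {h | ∃ p : (towerField C t l)[X], p.Monic ∧ h = Differential.logDeriv (aeval (t l) p)}

theorem rowSpan_zero {n : ℕ} (t : Fin n → E) : rowSpan C t 0 = logDerivSpan C ⊥ := rfl

theorem rowSpan_succ {n : ℕ} (t : Fin n → E) (l : Fin n) :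
    rowSpan C t l.succ = Submodule.span C
      {h | ∃ p : (towerField C t l)[X], p.Monic ∧ h = Differential.logDeriv (aeval (t l) p)} := rfl

theorem aeval_mem_towerField_succ {n : ℕ} (t : Fin n → E) (l : Fin n) (p : (towerField C t l)[X]) :
    aeval (t l) p ∈ towerField C t (l + 1) := by
  rw [mem_towerField_succ, IntermediateField.mem_adjoin_simple_iff]
  exact ⟨p, 1, by simp⟩

theorem rowSpan_le_logDerivSpan {n : ℕ} (t : Fin n → E) (a : Fin (n + 1)) :
    rowSpan C t a ≤ logDerivSpan C (towerField C t a) := by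
  induction a using Fin.cases with
  | zero => rw [rowSpan_zero, Fin.val_zero, towerField_zero]
  | succ l =>
    refine Submodule.span_le.mpr ?_
    rintro _ ⟨p, -, rfl⟩
    exact logDeriv_mem_logDerivSpan (aeval_mem_towerField_succ t l p)

theorem logDeriv_aeval_eq {M : Type*} [Field M] [Algebra M E] (s : E) (p : M[X])
    (hp : aeval s p ≠ 0) :
    ∃ (c : M) (q : M[X]), q.Monic ∧ Differential.logDeriv (aeval s p) =
      Differential.logDeriv (algebraMap M E c) + Differential.logDeriv (aeval s q) := by
  have h0 : p ≠ 0 := by rintro rfl; simp at hp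
  have hl : p.leadingCoeff ≠ 0 := leadingCoeff_ne_zero.mpr h0
  have e : p = C p.leadingCoeff * (p * C p.leadingCoeff⁻¹) := by
    rw [mul_comm p, ← mul_assoc, ← C_mul, mul_inv_cancel₀ hl, C_1, one_mul]
  have e' : aeval s p = algebraMap M E p.leadingCoeff * aeval s (p * C p.leadingCoeff⁻¹) := by
    conv_lhs => rw [e]
    rw [map_mul, aeval_C]
  refine ⟨p.leadingCoeff, p * C p.leadingCoeff⁻¹, monic_mul_leadingCoeff_inv h0, ?_⟩
  rw [e'] at hp
  rw [e', Differential.logDeriv_mul _ _ (left_ne_zero_of_mul hp) (right_ne_zero_of_mul hp)]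

/-- In a quotient of polynomials in `t l` the leading coefficients contribute logarithmic
derivatives over the smaller field, and the monic parts contribute to the new row. -/
theorem logDerivSpan_succ_le {n : ℕ} (t : Fin n → E) (l : Fin n) :
    logDerivSpan C (towerField C t (l + 1)) ≤
      logDerivSpan C (towerField C t l) ⊔ rowSpan C t l.succ := by
  refine Submodule.span_le.mpr ?_
  rintro _ ⟨g, hg, h0, rfl⟩
  obtain ⟨p, q, rfl⟩ := exists_fraction_of_mem_towerField_succ t l hg
  have hq : aeval (t l) q ≠ 0 := by rintro h; simp [h] at h0
  have hp : aeval (t l) p ≠ 0 := by rintro h; simp [h] at h0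
  obtain ⟨c, p', hp', ep⟩ := logDeriv_aeval_eq (t l) p hp
  obtain ⟨d, q', hq', eq⟩ := logDeriv_aeval_eq (t l) q hq
  rw [Differential.logDeriv_div _ _ hp hq, ep, eq]
  have key : ∀ (c : towerField C t l) (p : (towerField C t l)[X]), p.Monic →
      Differential.logDeriv (algebraMap (towerField C t l) E c) +
        Differential.logDeriv (aeval (t l) p) ∈
      logDerivSpan C (towerField C t l) ⊔ rowSpan C t l.succ := fun c p hp =>
    Submodule.add_mem_sup (logDeriv_mem_logDerivSpan c.2) (Submodule.subset_span ⟨p, hp, rfl⟩)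
  exact sub_mem (key c p' hp') (key d q' hq')

/-- Splitting a combination of logarithmic derivatives into rows. -/
theorem exists_rows_of_mem_logDerivSpan {n : ℕ} (t : Fin n → E) {b : ℕ} (hb : b ≤ n) {x : E}
    (hx : x ∈ logDerivSpan C (towerField C t b)) :
    ∃ L : Fin (n + 1) → E, (∀ a, L a ∈ rowSpan C t a) ∧ (∀ a, b < a.val → L a = 0) ∧
      x = ∑ a, L a := by
  classical
  induction b generalizing x with
  | zero =>
    refine ⟨Pi.single 0 x, fun a => ?_, fun a ha => ?_, by simp⟩
    · by_cases h : a = 0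
      · subst h
        rw [Pi.single_eq_same, rowSpan_zero, ← towerField_zero t]
        exact hx
      · rw [Pi.single_eq_of_ne h]; exact zero_mem _
    · exact Pi.single_eq_of_ne (by rintro rfl; simp at ha) _
  | succ b ih =>
    obtain ⟨y, hy, z, hz, rfl⟩ := Submodule.mem_sup.mp (logDerivSpan_succ_le t ⟨b, hb⟩ hx)
    obtain ⟨L, hL, hL0, rfl⟩ := ih (by omega) hy
    refine ⟨L + Pi.single (Fin.succ ⟨b, hb⟩) z, fun a => add_mem (hL a) ?_, fun a ha => ?_, ?_⟩
    · by_cases h : a = Fin.succ ⟨b, hb⟩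
      · subst h
        rwa [Pi.single_eq_same]
      · rw [Pi.single_eq_of_ne h]; exact zero_mem _
    · rw [Pi.add_apply, hL0 a (by omega), zero_add]
      exact Pi.single_eq_of_ne (by rintro rfl; simp at ha) _
    · simp [Finset.sum_add_distrib]

/-! ### The base field and the constants -/

theorem baseField_fraction {f : E} (hf : f ∈ (⊥ : IntermediateField (RatFunc C) E)) :
    ∃ p q : C[X], f = aeval (algebraMap (RatFunc C) E RatFunc.X) p /
      aeval (algebraMap (RatFunc C) E RatFunc.X) q := by
  obtain ⟨g, rfl⟩ := IntermediateField.mem_bot.mp hf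
  have h : ∀ p : C[X], aeval (algebraMap (RatFunc C) E RatFunc.X) p =
      algebraMap (RatFunc C) E (algebraMap C[X] (RatFunc C) p) := fun p => by
    rw [aeval_algebraMap_apply, ← RatFunc.algebraMap_X, aeval_algebraMap_apply, aeval_X_left_apply]
  exact ⟨g.num, g.denom, by rw [h, h, ← map_div₀, RatFunc.num_div_denom]⟩

/-- `C(x)` is itself a simple primitive extension: give `C` the zero derivation and take `x′ = 1`.
Leading coefficients are constants, so every logarithmic derivative over `C(x)` comes from monic
polynomials in `x`. -/
theorem baseField_integrable [CharZero C] {f y : E} (hf : f ∈ (⊥ : IntermediateField (RatFunc C) E))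
    (hy : y ∈ logDerivSpan C (⊥ : IntermediateField (RatFunc C) E)) (h : f′ = y) :
    y = 0 ∧ f ∈ Set.range (algebraMap C E) := by
  let _ : Differential C := ⟨0⟩
  have : DifferentialAlgebra C E := ⟨fun c => by
    rw [deriv_const, show c′ = 0 from rfl, map_zero]⟩
  have hr : ∀ g : C, g′ ≠ 1 := fun g h => zero_ne_one (α := C) h
  have hs : (algebraMap (RatFunc C) E RatFunc.X)′ = algebraMap C E 1 := by
    rw [deriv_algebraMap, ← RatFunc.algebraMap_X, deriv_algebraMap_polynomial]
    simp
  have hle : logDerivSpan C (⊥ : IntermediateField (RatFunc C) E) ≤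
      monicLogDerivSpan C (algebraMap (RatFunc C) E RatFunc.X) := by
    refine Submodule.span_le.mpr ?_
    rintro _ ⟨g, hg, h0, rfl⟩
    obtain ⟨p, q, rfl⟩ := baseField_fraction hg
    obtain ⟨hp, hq⟩ := (div_ne_zero_iff.mp h0)
    obtain ⟨c, p', hp', ep⟩ := logDeriv_aeval_eq _ p hp
    obtain ⟨d, q', hq', eq⟩ := logDeriv_aeval_eq _ q hq
    rw [Differential.logDeriv_div _ _ hp hq, ep, eq,
      (Differential.logDeriv_eq_zero _).mpr (deriv_const E c),
      (Differential.logDeriv_eq_zero _).mpr (deriv_const E d), zero_add, zero_add]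
    exact sub_mem (Submodule.subset_span ⟨p', hp', rfl⟩) (Submodule.subset_span ⟨q', hq', rfl⟩)
  obtain ⟨p, q, rfl⟩ := baseField_fraction hf
  obtain ⟨hy0, c, g, -, e⟩ := eq_linear_of_deriv_eq hr hs p q (A := 0) (hle hy)
    (by rw [h, map_zero, zero_add])
  refine ⟨hy0, ?_⟩
  rw [hy0, e] at h
  have hc : c = 0 := by
    simpa [Derivation.leibniz, deriv_const, hs] using h
  exact ⟨g, by rw [e, hc]; simp⟩

theorem mem_range_of_deriv_eq_zero_of_tower [CharZero C] {n : ℕ} {t : Fin n → E}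
    (ht : IsLogarithmicTower C t) {f : E} (hf : f′ = 0) : f ∈ Set.range (algebraMap C E) := by
  have key : ∀ m, m ≤ n → ∀ f ∈ towerField C t m, f′ = 0 → f ∈ Set.range (algebraMap C E) := by
    intro m
    induction m with
    | zero =>
      intro _ f hf h
      rw [towerField_zero] at hf
      exact (baseField_integrable hf (zero_mem _) h).2
    | succ m ih =>
      intro hm f hf h
      exact ih (by omega) f ((ht.generator ⟨m, hm⟩).constants f
        ((mem_towerField_succ t ⟨m, hm⟩).mp hf) h) h
  exact key n le_rfl f (by rw [ht.generates]; trivial) hf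

end Derivations

/-- In a nontrivial relation the vector with the largest index would be a combination of earlier
ones. The labels `κ` allow this to be applied within one row at a time. -/
theorem eq_zero_of_notMem_span_initial {ι ρ K V : Type*} [Field K] [AddCommGroup V] [Module K V]
    [Fintype ι] [LinearOrder ι] {x : ι → V} {κ : ι → ρ}
    (h : ∀ j, x j ∉ Submodule.span K (x '' {i | κ i = κ j ∧ i < j})) (r : ρ) {c : ι → K}
    (hr : ∀ i, κ i ≠ r → c i = 0) (hc : ∑ i, c i • x i = 0) : c = 0 := by
  classical
  by_contra hne
  obtain ⟨i₀, hi₀⟩ := Function.ne_iff.mp hne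
  obtain ⟨i, hi, hmax⟩ := Finset.exists_max_image (Finset.univ.filter fun i => c i ≠ 0) id
    ⟨i₀, by simpa using hi₀⟩
  have hci : c i ≠ 0 := (Finset.mem_filter.mp hi).2
  have hκ : ∀ j, c j ≠ 0 → κ j = r := fun j hj => not_imp_comm.mp (hr j) hj
  apply h i
  rw [← Finset.add_sum_erase _ _ (Finset.mem_univ i)] at hc
  have h1 : ∑ j ∈ Finset.univ.erase i, c j • x j ∈
      Submodule.span K (x '' {l | κ l = κ i ∧ l < i}) := by
    refine sum_mem fun j hj => ?_
    by_cases hcj : c j = 0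
    · rw [hcj, zero_smul]; exact zero_mem _
    · have : j ≤ i := hmax j (by simpa using hcj)
      exact Submodule.smul_mem _ _ (Submodule.subset_span
        ⟨j, ⟨(hκ j hcj).trans (hκ i hci).symm,
          lt_of_le_of_ne this (Finset.ne_of_mem_erase hj)⟩, rfl⟩)
  have h2 : c i • x i ∈ Submodule.span K (x '' {l | κ l = κ i ∧ l < i}) := by
    rw [eq_neg_of_add_eq_zero_left hc]; exact neg_mem h1
  simpa [smul_smul, hci] using Submodule.smul_mem _ (c i)⁻¹ h2

theorem linearIndependent_of_notMem_span_initial {ι K V : Type*} [Field K] [AddCommGroup V]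
    [Module K V] [Fintype ι] [LinearOrder ι] {x : ι → V}
    (h : ∀ j, x j ∉ Submodule.span K (x '' {i | i < j})) : LinearIndependent K x := by
  rw [Fintype.linearIndependent_iff]
  intro c hc
  exact congrFun (eq_zero_of_notMem_span_initial (κ := fun _ => ()) (by simpa using h) ()
    (by simp) hc)

/-! ### A greedy basis of the span of the generators -/

section Flag

variable {C : Type*} [Field C] {E : Type*} [Field E] [Algebra C E] [Algebra (RatFunc C) E]
  [IsScalarTower C (RatFunc C) E] [Differential E] [DifferentialAlgebra (RatFunc C) E]

theorem IsLogarithmicTower.notMem {n : ℕ} {t : Fin n → E} (ht : IsLogarithmicTower C t)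
    (j : Fin n) : t j ∉ towerField C t j := fun h =>
  (ht.generator j).transcendental
    (isAlgebraic_algebraMap (A := E) (⟨t j, h⟩ : towerField C t j))

theorem IsLogarithmicTower.linearIndependent {n : ℕ} {t : Fin n → E}
    (ht : IsLogarithmicTower C t) : LinearIndependent C t := by
  rw [Fintype.linearIndependent_iff]
  intro c hc
  have := eq_zero_of_sum_smul_mem ht.notMem c (by rw [hc]; exact zero_mem _)
  simp [this]

theorem span_le_constSubmodule {n : ℕ} {s : Fin n → E} {m : ℕ} :
    Submodule.span C (s '' {i | (i : ℕ) < m}) ≤ constSubmodule (towerField C s m) := by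
  refine Submodule.span_le.mpr ?_
  rintro _ ⟨i, hi, rfl⟩
  exact mem_towerField s hi

theorem finrank_span_initial_le {n : ℕ} (s : Fin n → E) {m : ℕ} (hm : m ≤ n) :
    Module.finrank C (Submodule.span C (s '' {i | (i : ℕ) < m})) ≤ m := by
  have h : s '' {i | (i : ℕ) < m} = Set.range fun i : Fin m => s (Fin.castLE hm i) := by
    ext x
    constructor
    · rintro ⟨i, hi, rfl⟩; exact ⟨⟨i, hi⟩, rfl⟩
    · rintro ⟨i, rfl⟩; exact ⟨_, i.2, rfl⟩
  rw [h]
  simpa [Set.finrank] using finrank_range_le_card (R := C) fun i : Fin m => s (Fin.castLE hm i)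

/-- `s` lists the first `m` vectors of a basis of the span of `t` in which the derivative of each
vector is a combination of logarithmic derivatives over a field generated by as few of the
previous vectors as possible. -/
structure IsPartialFlag {n : ℕ} (t s : Fin n → E) (k : Fin n → ℕ) (m : ℕ) : Prop where
  le : ∀ j : Fin n, (j : ℕ) < m → k j ≤ j
  mem_span : ∀ j : Fin n, (j : ℕ) < m → s j ∈ Submodule.span C (Set.range t)
  deriv_mem : ∀ j : Fin n, (j : ℕ) < m → (s j)′ ∈ logDerivSpan C (towerField C s (k j))
  notMem : ∀ j : Fin n, (j : ℕ) < m → s j ∉ Submodule.span C (s '' {i | (i : ℕ) < j})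
  minimal : ∀ j : Fin n, (j : ℕ) < m → ∀ b, b < k j → ∀ τ ∈ Submodule.span C (Set.range t),
    τ′ ∈ logDerivSpan C (towerField C s b) → τ ∈ Submodule.span C (s '' {i | (i : ℕ) < j})

/-- The next vector is taken outside the span of the previous ones with the least field index `b`.
Conditions on the old vectors concern only still older ones and are not disturbed. -/
theorem IsPartialFlag.succ {n : ℕ} {t : Fin n → E} (ht : IsLogarithmicTower C t) {s : Fin n → E}
    {k : Fin n → ℕ} {m : ℕ} (hm : m < n) (h : IsPartialFlag (C := C) t s k m) :
    ∃ s' k', IsPartialFlag (C := C) t s' k' (m + 1) := by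
  classical
  have hfin : Module.finrank C (Submodule.span C (Set.range t)) = n := by
    rw [finrank_span_eq_card ht.linearIndependent, Fintype.card_fin]
  have hfd : FiniteDimensional C (Submodule.span C (s '' {i | (i : ℕ) < m})) :=
    FiniteDimensional.span_of_finite C (Set.toFinite _)
  have hex : ∃ b, ∃ τ ∈ Submodule.span C (Set.range t),
      τ′ ∈ logDerivSpan C (towerField C s b) ∧
        τ ∉ Submodule.span C (s '' {i | (i : ℕ) < m}) ∧ b ≤ m := by
    -- The span of `m` vectors cannot contain the `n` independent generators.
    have hne : ∃ i, t i ∉ Submodule.span C (s '' {i | (i : ℕ) < m}) := by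
      by_contra hall
      push Not at hall
      have h1 : Submodule.span C (Set.range t) ≤ Submodule.span C (s '' {i | (i : ℕ) < m}) :=
        Submodule.span_le.mpr (by rintro _ ⟨i, rfl⟩; exact hall i)
      have h2 := Submodule.finrank_mono h1
      have h3 := finrank_span_initial_le (C := C) s hm.le
      omega
    -- All generators before the first missing `t i` lie in the field of the first `m` flag vectors,
    -- so `b = m` is admissible.
    obtain ⟨i, hi, hmin⟩ := WellFounded.has_min (wellFounded_lt (α := Fin n))
      {i | t i ∉ Submodule.span C (s '' {i | (i : ℕ) < m})} hne
    refine ⟨m, t i, Submodule.subset_span ⟨i, rfl⟩, ?_, hi, le_rfl⟩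
    refine logDerivSpan_mono ?_ (ht.generator i).deriv_mem_span
    rw [towerField_le_iff]
    intro j hj
    apply span_le_constSubmodule
    by_contra hj'
    exact hmin j hj' hj
  obtain ⟨τ, hτ, hτ', hτm, hkm⟩ := Nat.find_spec hex
  have hmin : ∀ b < Nat.find hex, ∀ τ ∈ Submodule.span C (Set.range t),
      τ′ ∈ logDerivSpan C (towerField C s b) → τ ∈ Submodule.span C (s '' {i | (i : ℕ) < m}) := by
    intro b hb τ h1 h2
    by_contra h3
    exact Nat.find_min hex hb ⟨τ, h1, h2, h3, by omega⟩
  generalize Nat.find hex = K at *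
  have himg : ∀ b ≤ m, Function.update s ⟨m, hm⟩ τ '' {i | (i : ℕ) < b} = s '' {i | (i : ℕ) < b} :=
    fun b hb => Set.image_congr fun i (hi : (i : ℕ) < b) =>
      Function.update_of_ne (by rintro rfl; simp at hi; omega) _ _
  have hfield : ∀ b ≤ m, towerField C (Function.update s ⟨m, hm⟩ τ) b = towerField C s b :=
    fun b hb => by rw [towerField, himg b hb, towerField]
  have hold : ∀ j : Fin n, (j : ℕ) < m → Function.update s ⟨m, hm⟩ τ j = s j ∧
      Function.update k ⟨m, hm⟩ K j = k j := fun j hj => by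
    have : j ≠ ⟨m, hm⟩ := by rintro rfl; simp at hj
    exact ⟨Function.update_of_ne this _ _, Function.update_of_ne this _ _⟩
  have hcases : ∀ j : Fin n, (j : ℕ) < m + 1 → (j : ℕ) < m ∨ j = ⟨m, hm⟩ := fun j hj => by
    rcases (Nat.lt_succ_iff.mp hj).lt_or_eq with h | h
    · exact Or.inl h
    · exact Or.inr (Fin.ext h)
  refine ⟨Function.update s ⟨m, hm⟩ τ, Function.update k ⟨m, hm⟩ K, ?_, ?_, ?_, ?_, ?_⟩
  all_goals
    intro j hj
    rcases hcases j hj with hj | rfl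
  · rw [(hold j hj).2]; exact h.le j hj
  · simpa using hkm
  · rw [(hold j hj).1]; exact h.mem_span j hj
  · simpa using hτ
  · rw [(hold j hj).1, (hold j hj).2, hfield _ ((h.le j hj).trans hj.le)]
    exact h.deriv_mem j hj
  · rw [Function.update_self, Function.update_self, hfield _ hkm]
    exact hτ'
  · rw [(hold j hj).1, himg _ hj.le]; exact h.notMem j hj
  · rw [Function.update_self, himg _ le_rfl]; exact hτm
  · rw [(hold j hj).2, himg _ hj.le]
    intro b hb
    rw [hfield b (by have := h.le j hj; omega)]
    exact h.minimal j hj b hb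
  · rw [Function.update_self, himg _ le_rfl]
    intro b hb
    rw [hfield b (by omega)]
    exact hmin b hb

theorem exists_flag {n : ℕ} {t : Fin n → E} (ht : IsLogarithmicTower C t) :
    ∃ s k, IsPartialFlag (C := C) t s k n := by
  have key : ∀ m ≤ n, ∃ s k, IsPartialFlag (C := C) t s k m := by
    intro m
    induction m with
    | zero => exact fun _ => ⟨t, 0, by constructor <;> intro j hj <;> omega⟩
    | succ m ih =>
      intro hm
      obtain ⟨s, k, h⟩ := ih (by omega)
      exact h.succ ht hm
  exact key n le_rfl

namespace IsPartialFlag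

variable {n : ℕ} {t s : Fin n → E} {k : Fin n → ℕ}

/-- If `k j < k i` for some `i ≤ j`, minimality at `i` would put `s j` in the span of the vectors
before `i`. -/
theorem monotone (h : IsPartialFlag (C := C) t s k n) : Monotone k := by
  intro i j hij
  by_contra hk
  push Not at hk
  refine h.notMem j j.2 (Submodule.span_mono (Set.image_mono ?_)
    (h.minimal i i.2 (k j) hk (s j) (h.mem_span j j.2) (h.deriv_mem j j.2)))
  intro l hl
  exact lt_of_lt_of_le hl hij

theorem span_eq (ht : IsLogarithmicTower C t) (h : IsPartialFlag (C := C) t s k n) :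
    Submodule.span C (Set.range s) = Submodule.span C (Set.range t) := by
  have hs : LinearIndependent C s :=
    linearIndependent_of_notMem_span_initial fun j => h.notMem j j.2
  have hfd : FiniteDimensional C (Submodule.span C (Set.range t)) :=
    FiniteDimensional.span_of_finite C (Set.toFinite _)
  refine Submodule.eq_of_le_of_finrank_eq ?_ ?_
  · exact Submodule.span_le.mpr (by rintro _ ⟨i, rfl⟩; exact h.mem_span i i.2)
  · rw [finrank_span_eq_card hs, finrank_span_eq_card ht.linearIndependent]

end IsPartialFlag

end Flag

/-! ### Towers whose derivatives lie in single rows -/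

section RowTower

open Polynomial

variable {C : Type*} [Field C] {E : Type*} [Field E] [Algebra C E] [Algebra (RatFunc C) E]
  [IsScalarTower C (RatFunc C) E] [Differential E] [DifferentialAlgebra (RatFunc C) E]

/-- Every derivative lies in a single row, indexed by earlier generators, and the derivatives in
the same row are linearly independent over the constants. -/
structure IsRowTower {w : ℕ} (u : Fin w → E) (κ : Fin w → Fin (w + 1)) : Prop where
  le : ∀ i, (κ i : ℕ) ≤ i
  deriv_mem : ∀ i, (u i)′ ∈ rowSpan C u (κ i)
  indep : ∀ (r : Fin (w + 1)) (c : Fin w → C), (∀ i, κ i ≠ r → c i = 0) →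
    ∑ i, c i • (u i)′ = 0 → c = 0

namespace IsRowTower

variable {w : ℕ} {u : Fin w → E} {κ : Fin w → Fin (w + 1)}

theorem deriv_mem_towerField (h : IsRowTower (C := C) u κ) (m : ℕ) :
    ∀ x ∈ towerField C u m, x′ ∈ towerField C u m := by
  induction m using Nat.strong_induction_on with
  | _ m ih =>
    refine LogTower.deriv_mem_towerField fun j hj => ?_
    have hlt : (κ j : ℕ) < m := (h.le j).trans_lt hj
    exact towerField_mono u hlt.le (mem_constSubmodule.mp (logDerivSpan_le (ih _ hlt)
      (rowSpan_le_logDerivSpan u _ (h.deriv_mem j))))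

theorem deriv_generator_mem (h : IsRowTower (C := C) u κ) (j : Fin w) {m : ℕ} (hm : (κ j : ℕ) ≤ m) :
    (u j)′ ∈ towerField C u m :=
  towerField_mono u hm (mem_constSubmodule.mp (logDerivSpan_le (h.deriv_mem_towerField _)
    (rowSpan_le_logDerivSpan u _ (h.deriv_mem j))))

theorem rowSpan_le_monicLogDerivSpan (l : Fin w) [Differential (towerField C u l)] {y : E}
    (hy : y ∈ rowSpan C u l.succ) : y ∈ monicLogDerivSpan (towerField C u l) (u l) := by
  rw [rowSpan_succ] at hy
  induction hy using Submodule.span_induction with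
  | mem x hx => exact Submodule.subset_span hx
  | zero => exact zero_mem _
  | add x y _ _ hx hy => exact add_mem hx hy
  | smul c x _ hx =>
    have : c • x = (⟨algebraMap C E c, algebraMap_mem_intermediateField _ c⟩ :
        towerField C u l) • x := by
      rw [Algebra.smul_def, Algebra.smul_def]; rfl
    rw [this]
    exact Submodule.smul_mem _ _ hx

variable [CharZero C]

/-- A combination of derivatives over the field generated by the first `m` generators has an
antiderivative there only if it involves the first `m` generators alone. -/
theorem coeff_eq_zero (h : IsRowTower (C := C) u κ)
    (hconst : ∀ f : E, f′ = 0 → f ∈ Set.range (algebraMap C E)) {m : ℕ} (hm : m ≤ w)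
    {c : Fin w → C} (hc : ∀ i, m < (κ i : ℕ) → c i = 0) {f : E} (hf : f ∈ towerField C u m)
    (hfc : f′ = ∑ i, c i • (u i)′) : ∀ i : Fin w, m ≤ i → c i = 0 := by
  classical
  induction m generalizing c f with
  | zero =>
    intro i _
    have hc0 : ∀ i, κ i ≠ 0 → c i = 0 := fun i hi => hc i (Fin.pos_of_ne_zero hi)
    have hy : ∑ i, c i • (u i)′ ∈ logDerivSpan C (⊥ : IntermediateField (RatFunc C) E) := by
      rw [← rowSpan_zero u]
      refine sum_mem fun i _ => ?_
      by_cases hi : κ i = 0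
      · exact Submodule.smul_mem _ _ (hi ▸ h.deriv_mem i)
      · rw [hc0 i hi, zero_smul]; exact zero_mem _
    rw [towerField_zero] at hf
    rw [h.indep 0 c hc0 (baseField_integrable hf hy hfc).1]
    rfl
  | succ m ih =>
    set l : Fin w := ⟨m, hm⟩ with hl
    have hE : CharZero E := charZero_of_injective_algebraMap (algebraMap C E).injective
    let _ := intermediateDifferential (towerField C u l) (h.deriv_mem_towerField l)
    have := intermediateDifferential_algebra (towerField C u l) (h.deriv_mem_towerField l)
    set r : towerField C u l := ⟨(u l)′, h.deriv_generator_mem l (h.le l)⟩ with hr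
    -- The induction hypothesis for the `l`-th unit vector: an antiderivative of `(u l)′` in the
    -- smaller field would force `1 = 0`.
    have hrint : ∀ g : towerField C u l, g′ ≠ r := by
      intro g hg
      have := ih (by omega) (c := Pi.single l 1) (f := g) (fun i hi => ?_) g.2 ?_ l le_rfl
      · simp at this
      · refine Pi.single_eq_of_ne ?_ _
        rintro rfl
        have := h.le l
        simp only [hl] at this hi
        omega
      · have e : (g : E)′ = (r : E) := congrArg Subtype.val hg
        rw [e, Finset.sum_eq_single l]
        · simp [hr]
        · intro j _ hj; simp [Pi.single_eq_of_ne hj]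
        · simp
    -- The part `c₁` in the top row is a combination of logarithmic derivatives of monic polynomials
    -- in `u l`; the rest, `c₂`, gives an element of the field below.
    set c₁ : Fin w → C := fun i => if κ i = l.succ then c i else 0 with hc₁
    set c₂ : Fin w → C := fun i => if κ i = l.succ then 0 else c i with hc₂
    have hc₁₂ : ∀ i, c i = c₁ i + c₂ i := fun i => by simp only [hc₁, hc₂]; split_ifs <;> simp
    have hc₂0 : ∀ i, m < (κ i : ℕ) → c₂ i = 0 := by
      intro i hi
      simp only [hc₂]
      split_ifs with hs
      · rfl
      · apply hc
        have : (κ i : ℕ) ≠ m + 1 := fun e => hs (Fin.ext e)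
        omega
    have hy : ∑ i, c₁ i • (u i)′ ∈ rowSpan C u l.succ := by
      refine sum_mem fun i _ => ?_
      simp only [hc₁]
      split_ifs with hs
      · exact Submodule.smul_mem _ _ (hs ▸ h.deriv_mem i)
      · rw [zero_smul]; exact zero_mem _
    have hA : ∑ i, c₂ i • (u i)′ ∈ towerField C u l := by
      refine sum_mem fun i _ => ?_
      by_cases hi : m < (κ i : ℕ)
      · rw [hc₂0 i hi, zero_smul]; exact zero_mem _
      · exact smul_mem_intermediateField _ _ (h.deriv_generator_mem i (not_lt.mp hi))
    have hsum : ∑ i, c i • (u i)′ = ∑ i, c₂ i • (u i)′ + ∑ i, c₁ i • (u i)′ := by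
      rw [← Finset.sum_add_distrib]
      exact Finset.sum_congr rfl fun i _ => by rw [hc₁₂ i, add_smul, add_comm]
    obtain ⟨p, q, rfl⟩ := exists_fraction_of_mem_towerField_succ u l hf
    obtain ⟨hy0, e, g, he, hfe⟩ := eq_linear_of_deriv_eq hrint (s := u l) rfl p q
      (A := ⟨_, hA⟩) (rowSpan_le_monicLogDerivSpan l hy) (hfc.trans hsum)
    have hc₁0 : c₁ = 0 := h.indep l.succ c₁ (fun i hi => if_neg hi) hy0
    obtain ⟨e', he'⟩ := hconst e (congrArg Subtype.val he)
    -- Subtracting `e' • u l` from `f` lowers the field and changes only the coefficient at `l`, so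
    -- the induction hypothesis still controls all indices above `l`.
    have hg : (g : E)′ = ∑ i, (c₂ - Pi.single l e' : Fin w → C) i • (u i)′ := by
      have h1 := congrArg (fun x : E => x′) hfe
      simp only [hfc, hsum, hy0, add_zero, map_add] at h1
      have h2 : (algebraMap (towerField C u l) E e) * u l = e' • u l := by
        rw [Algebra.smul_def, he']; rfl
      rw [h2, deriv_smul_const] at h1
      have h3 : ∑ i, (Pi.single l e' : Fin w → C) i • (u i)′ = e' • (u l)′ := by
        rw [Finset.sum_eq_single l]
        · simp
        · intro j _ hj; simp [Pi.single_eq_of_ne hj]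
        · simp
      simp only [Pi.sub_apply, sub_smul, Finset.sum_sub_distrib]
      rw [h3, h1, add_sub_cancel_left]
      rfl
    have hc₂' := ih (by omega) (c := c₂ - Pi.single l e') (f := g) (fun i hi => ?_) g.2 hg
    · intro i hi
      have hil : i ≠ l := by rintro rfl; simp [hl] at hi
      have := hc₂' i (by omega)
      rw [Pi.sub_apply, Pi.single_eq_of_ne hil, sub_zero] at this
      rw [hc₁₂, hc₁0, this]
      simp
    · have hil : i ≠ l := by
        rintro rfl
        have := h.le l
        simp only [hl] at this hi
        omega
      rw [Pi.sub_apply, Pi.single_eq_of_ne hil, hc₂0 i hi, sub_zero]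

/-- Transcendence follows from non-integrability of `(u j)′`, which is `coeff_eq_zero` for a unit
vector. No new constants arise since all constants of `E` already lie in `C`. -/
theorem isLogarithmicTower (h : IsRowTower (C := C) u κ)
    (hconst : ∀ f : E, f′ = 0 → f ∈ Set.range (algebraMap C E)) (hgen : towerField C u w = ⊤) :
    IsLogarithmicTower C u := by
  classical
  refine ⟨hgen, fun j => ⟨⟨h.deriv_generator_mem j (h.le j), ?_, ?_⟩, ?_⟩⟩
  · have hE : CharZero E := charZero_of_injective_algebraMap (algebraMap C E).injective
    let _ := intermediateDifferential (towerField C u j) (h.deriv_mem_towerField j)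
    have := intermediateDifferential_algebra (towerField C u j) (h.deriv_mem_towerField j)
    refine transcendental_of_not_integrable
      (r := ⟨(u j)′, h.deriv_generator_mem j (h.le j)⟩) ?_ rfl
    intro g hg
    have := h.coeff_eq_zero hconst j.2.le (c := Pi.single j 1) (f := g) (fun i hi => ?_) g.2 ?_ j
      le_rfl
    · simp at this
    · refine Pi.single_eq_of_ne ?_ _
      rintro rfl
      exact absurd (h.le i) (not_le.mpr hi)
    · have e : (g : E)′ = (u j)′ := congrArg Subtype.val hg
      rw [e, Finset.sum_eq_single j]
      · simp
      · intro i _ hi; simp [Pi.single_eq_of_ne hi]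
      · simp
  · intro f _ hf
    obtain ⟨c, rfl⟩ := hconst f hf
    exact algebraMap_mem_intermediateField _ c
  · exact logDerivSpan_mono (towerField_mono u (h.le j))
      (rowSpan_le_logDerivSpan u _ (h.deriv_mem j))

end IsRowTower

end RowTower

/-! ### Directness of the matryoshka decomposition -/

section Matryoshka

open Polynomial

theorem eq_zero_of_mem_properFractions_of_eq_aeval {M Ω : Type*} [Field M] [Field Ω] [Algebra M Ω]
    {s : Ω} (hs : Transcendental M s) {x : Ω} (hx : x ∈ properFractions hs) (p : M[X])
    (hp : x = aeval s p) : x = 0 := by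
  obtain ⟨a, b, hb, hdeg, e⟩ := hx
  have nb : aeval s b ≠ 0 := fun h => hb ((transcendental_iff.mp hs) _ h)
  have h1 : p * b = a := by
    apply transcendental_iff_injective.mp hs
    rw [map_mul, ← hp, e, div_mul_cancel₀ _ nb]
  by_cases h0 : p = 0
  · rw [hp, h0, map_zero]
  · rw [← h1, degree_mul] at hdeg
    have := add_le_add_left (zero_le_degree_iff.mpr h0) b.degree
    rw [zero_add] at this
    exact absurd hdeg (not_lt.mpr this)

variable {C : Type*} [Field C] {E : Type*} [Field E] [Algebra C E] [Algebra (RatFunc C) E]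
  [IsScalarTower C (RatFunc C) E] {n : ℕ} {t : Fin n → E}

theorem algebraicIndepOn_later (ht : ∀ j : Fin n, Transcendental (towerField C t j) (t j))
    (l : Fin n) : AlgebraicIndepOn (towerField C t (l + 1)) t {k | l < k} := by
  have key : ∀ m : ℕ, AlgebraicIndepOn (towerField C t (l + 1)) t {k | l < k ∧ (k : ℕ) < m} := by
    intro m
    induction m with
    | zero =>
      have : {k : Fin n | l < k ∧ (k : ℕ) < 0} = ∅ := by ext; simp
      rw [this]
      exact algebraicIndependent_empty_type_iff.mpr (FaithfulSMul.algebraMap_injective _ _)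
    | succ m ih =>
      by_cases hm : (l : ℕ) < m ∧ m < n
      · have e : {k : Fin n | l < k ∧ (k : ℕ) < m + 1} =
            insert ⟨m, hm.2⟩ {k : Fin n | l < k ∧ (k : ℕ) < m} := by
          ext k
          simp only [Set.mem_ofPred_eq, Set.mem_insert_iff, Fin.ext_iff, Fin.lt_def]
          omega
        rw [e, AlgebraicIndepOn.insert_iff (by simp)]
        refine ⟨ih, fun halg => ht ⟨m, hm.2⟩ ?_⟩
        have hsub : ∀ x : Algebra.adjoin (towerField C t (l + 1))
            (t '' {k : Fin n | l < k ∧ (k : ℕ) < m}), (x : E) ∈ towerField C t m := by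
          rintro ⟨x, hx⟩
          induction hx using Algebra.adjoin_induction with
          | mem x hx => obtain ⟨k, hk, rfl⟩ := hx; exact mem_towerField t hk.2
          | algebraMap x => exact towerField_mono t hm.1 x.2
          | add x y _ _ hx hy => exact add_mem hx hy
          | mul x y _ _ hx hy => exact mul_mem hx hy
        let ι : Algebra.adjoin (towerField C t (l + 1))
            (t '' {k : Fin n | l < k ∧ (k : ℕ) < m}) →+* towerField C t m :=
          (algebraMap _ E).codRestrict (towerField C t m) hsub
        have hι : Function.Injective ι := fun x y h => 
          Subtype.ext (congrArg (fun z : towerField C t m => (z : E)) h)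
        obtain ⟨p, hp, hp0⟩ := halg
        refine ⟨p.map ι, (Polynomial.map_ne_zero_iff hι).mpr hp, ?_⟩
        rw [aeval_def, eval₂_map]
        exact hp0
      · have e : {k : Fin n | l < k ∧ (k : ℕ) < m + 1} = {k : Fin n | l < k ∧ (k : ℕ) < m} := by
          ext k
          have := k.2
          simp only [Set.mem_ofPred_eq, Fin.lt_def]
          omega
        rwa [e]
  have e : {k : Fin n | l < k} = {k : Fin n | l < k ∧ (k : ℕ) < n} := by ext k; simp
  rw [e]
  exact key n

/-- Writing the summand with polynomials in the later generators lets `algebraicIndepOn_later`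
compare coefficients. -/
theorem exists_mvPolynomial_of_mem_matryoshka_succ
    (ht : ∀ j : Fin n, Transcendental (towerField C t j) (t j)) (l : Fin n) {f : E}
    (hf : f ∈ matryoshka C t l.succ) :
    ∃ P : MvPolynomial {k // l < k} (towerField C t (l + 1)),
      (∀ d, ((P.coeff d : towerField C t (l + 1)) : E) ∈ properFractions (ht l)) ∧
        f = MvPolynomial.aeval (fun k : {k // l < k} => t k) P := by
  classical
  change f ∈ AddSubgroup.closure _ at hf
  induction hf using AddSubgroup.closure_induction with
  | mem f hf =>
    obtain ⟨a, m, ha, hm, rfl⟩ := hf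
    have hm' : ∃ d, m = MvPolynomial.aeval (fun k : {k // l < k} => t k)
        (MvPolynomial.monomial d (1 : towerField C t (l + 1))) := by
      induction hm using Submonoid.closure_induction with
      | mem x hx =>
        obtain ⟨k, hk, rfl⟩ := hx
        refine ⟨Finsupp.single ⟨k, hk⟩ 1, ?_⟩
        rw [MvPolynomial.aeval_monomial, map_one, one_mul, Finsupp.prod_single_index,
          pow_one]
        exact pow_zero _
      | one => exact ⟨0, by simp⟩
      | mul x y _ _ hx hy =>
        obtain ⟨d, rfl⟩ := hx
        obtain ⟨e, rfl⟩ := hy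
        exact ⟨d + e, by rw [← map_mul, MvPolynomial.monomial_mul, one_mul]⟩
    obtain ⟨d, rfl⟩ := hm'
    have hpr : a ∈ properFractions (ht l) := ha
    have haB : a ∈ towerField C t (l + 1) := by
      obtain ⟨p, q, -, -, rfl⟩ := ha
      rw [mem_towerField_succ, IntermediateField.mem_adjoin_simple_iff]
      exact ⟨p, q, rfl⟩
    refine ⟨MvPolynomial.monomial d ⟨a, haB⟩, fun e => ?_, ?_⟩
    · rw [MvPolynomial.coeff_monomial]
      split_ifs
      · exact hpr
      · exact zero_mem _
    · rw [MvPolynomial.aeval_monomial, MvPolynomial.aeval_monomial, map_one, one_mul]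
      rfl
  | zero => exact ⟨0, fun d => by simp, by simp⟩
  | add x y _ _ hx hy =>
    obtain ⟨P, hP, rfl⟩ := hx
    obtain ⟨Q, hQ, rfl⟩ := hy
    exact ⟨P + Q, fun d => by
      rw [MvPolynomial.coeff_add]; exact add_mem (hP d) (hQ d), by rw [map_add]⟩
  | neg x _ hx =>
    obtain ⟨P, hP, rfl⟩ := hx
    exact ⟨-P, fun d => by rw [MvPolynomial.coeff_neg]; exact neg_mem (hP d), by rw [map_neg]⟩

variable (C t) in
/-- The ring `K_l[t_l, t_{l+1}, …]`, which contains the summands before the one of `t_l`. -/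
def laterPolynomials (l : Fin n) :
    Subalgebra (Algebra.adjoin (towerField C t l) ({t l} : Set E)) E :=
  Algebra.adjoin _ (Set.range fun k : {k // l < k} => t k)

theorem mem_laterPolynomials_of_mem_towerField (l : Fin n) {x : E} (hx : x ∈ towerField C t l) :
    x ∈ laterPolynomials C t l :=
  (laterPolynomials C t l).algebraMap_mem
    (⟨x, (Algebra.adjoin _ _).algebraMap_mem (⟨x, hx⟩ : towerField C t l)⟩ :
      Algebra.adjoin (towerField C t l) ({t l} : Set E))

theorem generator_mem_laterPolynomials (l k : Fin n) : t k ∈ laterPolynomials C t l := by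
  rcases lt_trichotomy k l with h | rfl | h
  · exact mem_laterPolynomials_of_mem_towerField l (mem_towerField t h)
  · exact (laterPolynomials C t k).algebraMap_mem
      (⟨t k, Algebra.subset_adjoin rfl⟩ :
        Algebra.adjoin (towerField C t k) ({t k} : Set E))
  · exact Algebra.subset_adjoin ⟨⟨k, h⟩, rfl⟩

theorem mem_laterPolynomials_of_mem_matryoshka (l : Fin n) {r : Fin (n + 1)} (hr : r < l.succ)
    {f : E} (hf : f ∈ matryoshka C t r) : f ∈ laterPolynomials C t l := by
  induction r using Fin.cases with
  | zero =>
    change f ∈ Algebra.adjoin (RatFunc C) (Set.range t) at hf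
    induction hf using Algebra.adjoin_induction with
    | mem x hx => obtain ⟨k, rfl⟩ := hx; exact generator_mem_laterPolynomials l k
    | algebraMap x =>
      exact mem_laterPolynomials_of_mem_towerField l (IntermediateField.algebraMap_mem _ x)
    | add x y _ _ hx hy => exact add_mem hx hy
    | mul x y _ _ hx hy => exact mul_mem hx hy
  | succ j =>
    change f ∈ AddSubgroup.closure _ at hf
    induction hf using AddSubgroup.closure_induction with
    | mem f hf =>
      obtain ⟨a, m, ha, hm, rfl⟩ := hf
      refine mul_mem ?_ ?_
      · obtain ⟨p, q, -, -, rfl⟩ := ha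
        refine mem_laterPolynomials_of_mem_towerField l
          (towerField_mono t (Fin.lt_def.mp (Fin.succ_lt_succ_iff.mp hr)) ?_)
        rw [mem_towerField_succ, IntermediateField.mem_adjoin_simple_iff]
        exact ⟨p, q, rfl⟩
      · induction hm using Submonoid.closure_induction with
        | mem x hx => obtain ⟨k, -, rfl⟩ := hx; exact generator_mem_laterPolynomials l k
        | one => exact one_mem _
        | mul x y _ _ hx hy => exact mul_mem hx hy
    | zero => exact zero_mem _
    | add x y _ _ hx hy => exact add_mem hx hy
    | neg x _ hx => exact neg_mem hx

/-- By algebraic independence of the later generators, each coefficient is both proper and a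
polynomial in `t l`, hence zero. -/
theorem eq_zero_of_mem_matryoshka_of_mem_laterPolynomials
    (ht : ∀ j : Fin n, Transcendental (towerField C t j) (t j)) (l : Fin n) {f : E}
    (hf : f ∈ matryoshka C t l.succ) (hf' : f ∈ laterPolynomials C t l) : f = 0 := by
  obtain ⟨P, hP, hfP⟩ := exists_mvPolynomial_of_mem_matryoshka_succ ht l hf
  rw [laterPolynomials, Algebra.adjoin_range_eq_range_aeval] at hf'
  obtain ⟨Q, hQ⟩ := hf'
  have hpoly : ∀ x : Algebra.adjoin (towerField C t l) ({t l} : Set E),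
      ∃ p : (towerField C t l)[X], aeval (t l) p = (x : E) := by
    rintro ⟨x, hx⟩
    rw [Algebra.adjoin_singleton_eq_range_aeval] at hx
    exact hx
  have hsub : ∀ x : Algebra.adjoin (towerField C t l) ({t l} : Set E),
      (x : E) ∈ towerField C t (l + 1) := by
    intro x
    obtain ⟨p, hp⟩ := hpoly x
    rw [← hp]
    rw [mem_towerField_succ, IntermediateField.mem_adjoin_simple_iff]
    exact ⟨p, 1, by simp⟩
  let ι : Algebra.adjoin (towerField C t l) ({t l} : Set E) →+* towerField C t (l + 1) :=
    (algebraMap _ E).codRestrict (towerField C t (l + 1)) hsub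
  have hι : (algebraMap (towerField C t (l + 1)) E).comp ι = algebraMap _ E := rfl
  have hQ' : f = MvPolynomial.aeval (fun k : {k // l < k} => t k) (MvPolynomial.map ι Q) := by
    rw [MvPolynomial.aeval_def, MvPolynomial.eval₂_map, hι, ← hQ]
    rfl
  have hPQ : P = MvPolynomial.map ι Q := by
    apply (algebraicIndepOn_later ht l)
    exact hfP.symm.trans hQ'
  have hP0 : P = 0 := by
    ext d
    obtain ⟨p, hp⟩ := hpoly (Q.coeff d)
    refine eq_zero_of_mem_properFractions_of_eq_aeval (ht l) (hP d) p ?_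
    rw [hp, hPQ, MvPolynomial.coeff_map]
    rfl
  rw [hfP, hP0, map_zero]

/-- The matryoshka decomposition is direct. -/
theorem matryoshka_independent (ht : ∀ j : Fin n, Transcendental (towerField C t j) (t j))
    {g : Fin (n + 1) → E} (hg : ∀ i, g i ∈ matryoshka C t i) (h0 : ∑ i, g i = 0) : g = 0 := by
  classical
  by_contra hne
  obtain ⟨i₀, hi₀⟩ := Function.ne_iff.mp hne
  obtain ⟨i, hi, hmax⟩ := Finset.exists_max_image (Finset.univ.filter fun i => g i ≠ 0) id
    ⟨i₀, by simpa using hi₀⟩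
  have hgi : g i ≠ 0 := (Finset.mem_filter.mp hi).2
  have hlater : ∀ j, j ≠ i → g j ≠ 0 → j < i := fun j hj hgj =>
    lt_of_le_of_ne (hmax j (by simpa using hgj)) hj
  rw [← Finset.add_sum_erase _ _ (Finset.mem_univ i)] at h0
  induction i using Fin.cases with
  | zero =>
    apply hgi
    rwa [Finset.sum_eq_zero, add_zero] at h0
    intro j hj
    by_contra hgj
    exact absurd (hlater j (Finset.ne_of_mem_erase hj) hgj) (Fin.not_lt_zero _)
  | succ l =>
    -- The highest nonzero component is minus the sum of lower ones, all of which are polynomial in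
    -- `t l` and the later generators.
    refine hgi (eq_zero_of_mem_matryoshka_of_mem_laterPolynomials ht l (hg _) ?_)
    rw [eq_neg_of_add_eq_zero_left h0]
    refine neg_mem (sum_mem fun j hj => ?_)
    by_cases hgj : g j = 0
    · rw [hgj]; exact zero_mem _
    · exact mem_laterPolynomials_of_mem_matryoshka l
        (hlater j (Finset.ne_of_mem_erase hj) hgj) (hg j)

theorem proj_eq_single (ht : ∀ j : Fin n, Transcendental (towerField C t j) (t j))
    {r : Fin (n + 1)} {f : E} (hf : f ∈ matryoshka C t r) (i : Fin (n + 1)) :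
    proj C t i f = (Pi.single r f : Fin (n + 1) → E) i := by
  classical
  have hd : IsMatryoshkaDecomposition C t f (Pi.single r f) := by
    refine ⟨fun i => ?_, by simp⟩
    by_cases h : i = r
    · subst h; rwa [Pi.single_eq_same]
    · rw [Pi.single_eq_of_ne h]; exact zero_mem _
  have hex : ∃ g, IsMatryoshkaDecomposition C t f g := ⟨_, hd⟩
  rw [proj, dif_pos hex]
  have hs := hex.choose_spec
  have := matryoshka_independent ht (g := hex.choose - Pi.single r f)
    (fun i => sub_mem (hs.1 i) (hd.1 i))
    (by simp only [Pi.sub_apply, Finset.sum_sub_distrib]; rw [hs.2, hd.2, sub_self])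
  rw [← sub_eq_zero]
  exact congrFun this i

variable [Differential E]

/-- Each derivative is its own only component, so `κ` is the significant vector and the derivatives
are the significant components. The bound `κ i ≤ i` keeps the nonzero entry within the rows `0, …, n
- 1` of the matrix. -/
theorem isWellGenerated_of_deriv_mem_matryoshka (ht : IsLogarithmicTower C t)
    {κ : Fin n → Fin (n + 1)} (hmono : Monotone κ) (hle : ∀ i, (κ i : ℕ) ≤ i)
    (hmem : ∀ i, (t i)′ ∈ matryoshka C t (κ i))
    (hind : LinearIndependent C fun i => (t i)′) : IsWellGenerated C t := by
  classical
  have htr : ∀ j : Fin n, Transcendental (towerField C t j) (t j) := fun j =>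
    (ht.generator j).transcendental
  have hproj : ∀ i j, proj C t i (t j)′ = (Pi.single (κ j) (t j)′ : Fin (n + 1) → E) i :=
    fun i j => proj_eq_single htr (hmem j) i
  have hne : ∀ j, (t j)′ ≠ 0 := fun j => hind.ne_zero j
  have hiff : ∀ i j, proj C t i (t j)′ ≠ 0 ↔ i = κ j := by
    intro i j
    rw [hproj]
    by_cases h : i = κ j
    · subst h; simp [hne j]
    · simp [h]
  have hvec : significantVector C t = κ := by
    funext j
    have : (Finset.univ.filter fun i => proj C t i (t j)′ ≠ 0) = {κ j} := by
      ext i; simp [hiff]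
    rw [significantVector, significantIndex]
    convert Finset.sup_singleton (f := id) (b := κ j)
    rfl
  have hcomp : significantComponent C t = fun j => (t j)′ := by
    funext j
    rw [significantComponent, hvec, hproj, Pi.single_eq_same]
  refine ⟨ht, by rwa [hcomp], by rwa [hvec], fun j => ?_⟩
  refine ⟨⟨κ j, (hle j).trans_lt j.2⟩, ?_, fun i hi => ?_⟩
  · exact (hiff _ j).mpr rfl
  · exact Fin.ext (show (i : ℕ) = κ j from congrArg Fin.val ((hiff _ j).mp hi))

variable [DifferentialAlgebra (RatFunc C) E] [CharZero C]

namespace IsRowTower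

variable {κ : Fin n → Fin (n + 1)}

theorem rowSpan_le_matryoshka (h : IsRowTower (C := C) t κ)
    (ht : ∀ j : Fin n, Transcendental (towerField C t j) (t j)) (r : Fin (n + 1)) {y : E}
    (hy : y ∈ rowSpan C t r) : y ∈ matryoshka C t r := by
  induction r using Fin.cases with
  | zero =>
    have h0 := h.deriv_mem_towerField 0
    rw [towerField_zero] at h0
    obtain ⟨x, rfl⟩ := IntermediateField.mem_bot.mp (mem_constSubmodule.mp (logDerivSpan_le h0 hy))
    exact (Algebra.adjoin (RatFunc C) (Set.range t)).algebraMap_mem x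
  | succ l =>
    let _ := intermediateDifferential (towerField C t l) (h.deriv_mem_towerField l)
    have := intermediateDifferential_algebra (towerField C t l) (h.deriv_mem_towerField l)
    have hp : y ∈ properFractions (ht l) :=
      monicLogDerivSpan_le_properFractions
        (r := (⟨(t l)′, h.deriv_generator_mem l (h.le l)⟩ : towerField C t l)) rfl (ht l)
        (rowSpan_le_monicLogDerivSpan l hy)
    exact AddSubgroup.subset_closure ⟨y, 1, hp, one_mem _, (mul_one y).symm⟩

/-- Directness splits a linear relation between the derivatives into its rows, and within a row
independence is part of `IsRowTower`. -/
theorem isWellGenerated (h : IsRowTower (C := C) t κ) (hmono : Monotone κ)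
    (hconst : ∀ f : E, f′ = 0 → f ∈ Set.range (algebraMap C E)) (hgen : towerField C t n = ⊤) :
    IsWellGenerated C t := by
  classical
  have ht := h.isLogarithmicTower hconst hgen
  have htr : ∀ j : Fin n, Transcendental (towerField C t j) (t j) := fun j =>
    (ht.generator j).transcendental
  refine isWellGenerated_of_deriv_mem_matryoshka ht hmono h.le
    (fun i => h.rowSpan_le_matryoshka htr _ (h.deriv_mem i)) ?_
  rw [Fintype.linearIndependent_iff]
  intro c hc j
  have hsplit : (fun r => ∑ i, (if κ i = r then c i else 0) • (t i)′) = 0 := by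
    refine matryoshka_independent htr (fun r => ?_) ?_
    · refine h.rowSpan_le_matryoshka htr r (sum_mem fun i _ => ?_)
      split_ifs with hr
      · exact Submodule.smul_mem _ _ (hr ▸ h.deriv_mem i)
      · rw [zero_smul]; exact zero_mem _
    · rw [Finset.sum_comm, ← hc]
      refine Finset.sum_congr rfl fun i _ => ?_
      rw [Finset.sum_eq_single (κ i)]
      · simp
      · intro r _ hr; rw [if_neg hr.symm, zero_smul]
      · simp
  have := congrFun (h.indep (κ j) (fun i => if κ i = κ j then c i else 0)
    (fun i hi => if_neg hi) (congrFun hsplit (κ j))) j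
  simpa using this

end IsRowTower

end Matryoshka

/-! ### Independence of the leading entries -/

section LeadingRow

variable {C : Type*} [Field C] [CharZero C] {E : Type*} [Field E] [Algebra C E]
  [Algebra (RatFunc C) E] [IsScalarTower C (RatFunc C) E] [Differential E]
  [DifferentialAlgebra (RatFunc C) E]

/-- If the leading entry of `s j` were a combination of earlier entries of its row, subtracting the
same combination `τ` of earlier vectors would push the derivative of `s j - τ` into lower rows,
against minimality. -/
theorem IsPartialFlag.leading_notMem {n : ℕ} {t s : Fin n → E} {k : Fin n → ℕ}
    (ht : IsLogarithmicTower C t) (h : IsPartialFlag (C := C) t s k n)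
    {L : Fin n → Fin (n + 1) → E} (hrow : ∀ j a, L j a ∈ rowSpan C s a)
    (h0 : ∀ j (a : Fin (n + 1)), k j < a → L j a = 0) (hsum : ∀ j, (s j)′ = ∑ a, L j a)
    (j : Fin n) (a : Fin (n + 1)) (ha : (a : ℕ) = k j) :
    L j a ∉ Submodule.span C ((fun i => L i a) '' {i | i < j}) := by
  classical
  intro hmem
  set N : Submodule C E := ⨆ b, ⨆ _ : b < a, rowSpan C s b with hN
  have hNmem : ∀ i ≤ j, (s i)′ - L i a ∈ N := by
    intro i hi
    rw [hsum, ← Finset.add_sum_erase _ _ (Finset.mem_univ a), add_sub_cancel_left]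
    refine sum_mem fun b hb => ?_
    rcases lt_or_gt_of_ne (Finset.ne_of_mem_erase hb) with hlt | hgt
    · exact Submodule.mem_iSup_of_mem b (Submodule.mem_iSup_of_mem hlt (hrow i b))
    · rw [h0 i b ((h.monotone hi).trans_lt (ha ▸ Fin.lt_def.mp hgt))]
      exact zero_mem _
  have key : ∀ y ∈ Submodule.span C ((fun i => L i a) '' {i | i < j}),
      ∃ τ ∈ Submodule.span C (s '' {i | (i : ℕ) < j}), τ′ - y ∈ N := by
    intro y hy
    induction hy using Submodule.span_induction with
    | mem y hy =>
      obtain ⟨i, hi, rfl⟩ := hy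
      exact ⟨s i, Submodule.subset_span ⟨i, hi, rfl⟩, hNmem i (le_of_lt hi)⟩
    | zero => exact ⟨0, zero_mem _, by simp⟩
    | add x y _ _ hx hy =>
      obtain ⟨σ, hσ, hσ'⟩ := hx
      obtain ⟨τ, hτ, hτ'⟩ := hy
      refine ⟨σ + τ, add_mem hσ hτ, ?_⟩
      rw [map_add, add_sub_add_comm]
      exact add_mem hσ' hτ'
    | smul c x _ hx =>
      obtain ⟨σ, hσ, hσ'⟩ := hx
      refine ⟨c • σ, Submodule.smul_mem _ _ hσ, ?_⟩
      rw [deriv_smul_const, ← smul_sub]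
      exact Submodule.smul_mem _ _ hσ'
  obtain ⟨τ, hτ, hτ'⟩ := key _ hmem
  have hd : (s j - τ)′ ∈ N := by
    have := sub_mem (hNmem j le_rfl) hτ'
    rwa [sub_sub_sub_cancel_right, ← map_sub] at this
  have hspan : s j - τ ∈ Submodule.span C (Set.range t) := by
    refine sub_mem (h.mem_span j j.2) ?_
    rw [← h.span_eq ht]
    exact Submodule.span_mono (Set.image_subset_range _ _) hτ
  have hsuff : s j - τ ∈ Submodule.span C (s '' {i | (i : ℕ) < j}) := by
    -- In row `0` nothing lies below, so `s j - τ` is a constant and a combination of generators,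
    -- hence zero. In row `l.succ` the lower rows live over the field of index `l < k j`, where
    -- minimality applies.
    induction a using Fin.cases with
    | zero =>
      have hN0 : N = ⊥ := by simp [hN]
      rw [hN0, Submodule.mem_bot] at hd
      obtain ⟨c, hc⟩ := mem_range_of_deriv_eq_zero_of_tower ht hd
      obtain ⟨d, hd⟩ := (Submodule.mem_span_range_iff_exists_fun C).mp hspan
      have hd0 := eq_zero_of_sum_smul_mem ht.notMem d (by
        rw [hd, ← hc]; exact algebraMap_mem_intermediateField _ c)
      rw [← hd, hd0]
      simp
    | succ l =>
      refine h.minimal j j.2 l (by simp at ha; omega) _ hspan ?_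
      refine (iSup₂_le fun b hb => ?_ : N ≤ _) hd
      exact (rowSpan_le_logDerivSpan s b).trans
        (logDerivSpan_mono (towerField_mono s (by simpa [Fin.lt_def, Nat.lt_succ_iff] using hb)))
  apply h.notMem j j.2
  simpa using add_mem hsuff hτ

end LeadingRow

/-! ### Transporting rows to the extension -/

section RowMap

open Polynomial

variable {C : Type*} [Field C] {E : Type*} [Field E] [Algebra C E]
  [Algebra (RatFunc C) E] [IsScalarTower C (RatFunc C) E] [Differential E]
  [DifferentialAlgebra (RatFunc C) E] {F : Type*} [Field F] [Algebra C F]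
  [Algebra (RatFunc C) F] [IsScalarTower C (RatFunc C) F] [Differential F]
  [DifferentialAlgebra (RatFunc C) F] {φ : E →ₐ[RatFunc C] F}

theorem map_smul_const (φ : E →ₐ[RatFunc C] F) (c : C) (x : E) : φ (c • x) = c • φ x := by
  rw [Algebra.smul_def, Algebra.smul_def, map_mul, IsScalarTower.algebraMap_apply C (RatFunc C) E,
    IsScalarTower.algebraMap_apply C (RatFunc C) F, AlgHom.commutes]

theorem map_logDeriv (hφ : ∀ x, φ x′ = (φ x)′) (x : E) :
    φ (Differential.logDeriv x) = Differential.logDeriv (φ x) := by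
  rw [Differential.logDeriv, map_div₀, hφ, Differential.logDeriv]

theorem map_mem_rowSpan_zero (hφ : ∀ x, φ x′ = (φ x)′) {n w : ℕ} (s : Fin n → E) (u : Fin w → F)
    {y : E} (hy : y ∈ rowSpan C s 0) : φ y ∈ rowSpan C u 0 := by
  rw [rowSpan_zero] at *
  induction hy using Submodule.span_induction with
  | mem y hy =>
    obtain ⟨g, hg, -, rfl⟩ := hy
    obtain ⟨x, rfl⟩ := IntermediateField.mem_bot.mp hg
    rw [map_logDeriv hφ, AlgHom.commutes]
    exact logDeriv_mem_logDerivSpan (IntermediateField.algebraMap_mem _ x)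
  | zero => rw [map_zero]; exact zero_mem _
  | add x y _ _ hx hy => rw [map_add]; exact add_mem hx hy
  | smul c x _ hx => rw [map_smul_const]; exact Submodule.smul_mem _ _ hx

/-- `φ (s l)` is a translate of `u q` by an element of the field before it, and substituting `X + c`
keeps a polynomial monic. -/
theorem map_mem_rowSpan_succ (hφ : ∀ x, φ x′ = (φ x)′) {n w : ℕ} {s : Fin n → E} {u : Fin w → F}
    {l : Fin n} {q : Fin w} (hfield : ∀ x ∈ towerField C s l, φ x ∈ towerField C u q)
    (hgen : φ (s l) - u q ∈ towerField C u q) {y : E} (hy : y ∈ rowSpan C s l.succ) :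
    φ y ∈ rowSpan C u q.succ := by
  rw [rowSpan_succ] at hy
  induction hy using Submodule.span_induction with
  | mem y hy =>
    obtain ⟨p, hp, rfl⟩ := hy
    let ψ : towerField C s l →+* towerField C u q :=
      ((φ : E →+* F).comp (algebraMap (towerField C s l) E)).codRestrict (towerField C u q)
        fun x => hfield x x.2
    have hψ : (algebraMap (towerField C u q) F).comp ψ =
        (φ : E →+* F).comp (algebraMap (towerField C s l) E) := rfl
    rw [map_logDeriv hφ, rowSpan_succ]
    refine Submodule.subset_span ⟨(p.map ψ).comp (X + Polynomial.C ⟨_, hgen⟩),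
      (hp.map ψ).comp (monic_X_add_C _) (by simp), ?_⟩
    congr 1
    rw [aeval_comp, map_add, aeval_X, aeval_C]
    have e : u q + algebraMap (towerField C u q) F ⟨φ (s l) - u q, hgen⟩ = φ (s l) :=
      add_sub_cancel _ _
    rw [e, aeval_def, aeval_def, eval₂_map, hψ]
    exact hom_eval₂ p _ (φ : E →+* F) _
  | zero => rw [map_zero]; exact zero_mem _
  | add x y _ _ hx hy => rw [map_add]; exact add_mem hx hy
  | smul c x _ hx => rw [map_smul_const]; exact Submodule.smul_mem _ _ hx

end RowMap

/-! ### Pivots and the new tower -/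

section Splitting

variable {C : Type*} [Field C] [CharZero C] {E : Type*} [Field E] [Algebra C E]
  [Algebra (RatFunc C) E] [IsScalarTower C (RatFunc C) E] [Differential E]
  [DifferentialAlgebra (RatFunc C) E]
  {F : Type*} [Field F] [Algebra C F] [Algebra (RatFunc C) F] [IsScalarTower C (RatFunc C) F]
  [Differential F] [DifferentialAlgebra (RatFunc C) F]

open scoped Classical in
/-- The positions in the matrix `L` of entries that are not in the span of the previous entries of
their row. -/
def pivots (C : Type*) [Field C] {E : Type*} [Field E] [Algebra C E] {n : ℕ}
    (L : Fin n → Fin (n + 1) → E) : Finset (Fin (n + 1) ×ₗ Fin n) :=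
  Finset.univ.filter fun p => L (ofLex p).2 (ofLex p).1 ∉
    Submodule.span C ((fun i => L i (ofLex p).1) '' {i | i < (ofLex p).2})

theorem mem_pivots {n : ℕ} {L : Fin n → Fin (n + 1) → E} {a : Fin (n + 1)} {j : Fin n} :
    toLex (a, j) ∈ pivots C L ↔
      L j a ∉ Submodule.span C ((fun i => L i a) '' {i | i < j}) := by
  simp [pivots]

/-- A pivot is nonzero, so column `j` has pivots only in rows `0, …, j`; the bound is the sum of `j
+ 1` over `j < n`. -/
theorem card_pivots_le {n : ℕ} {L : Fin n → Fin (n + 1) → E} {k : Fin n → ℕ} (hk : ∀ j, k j ≤ j)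
    (h0 : ∀ j (a : Fin (n + 1)), k j < a → L j a = 0) :
    (pivots C L).card ≤ n * (n + 1) / 2 := by
  have hle : ∀ p : pivots C L, ((ofLex p.1).1 : ℕ) < (ofLex p.1).2 + 1 := by
    intro p
    by_contra hlt
    have hp : toLex ((ofLex p.1).1, (ofLex p.1).2) ∈ pivots C L := p.2
    have h : L (ofLex p.1).2 (ofLex p.1).1 = 0 :=
      h0 _ _ (lt_of_le_of_lt (hk _) (not_le.mp fun h => hlt (Nat.lt_succ_of_le h)))
    exact mem_pivots.mp hp (h ▸ zero_mem _)
  have hinj : Function.Injective fun p : pivots C L =>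
      (⟨(ofLex p.1).2, ⟨(ofLex p.1).1, hle p⟩⟩ : Σ j : Fin n, Fin (j + 1)) := by
    rintro ⟨⟨a, j⟩, hp⟩ ⟨⟨b, l⟩, hq⟩ h
    simp only [Sigma.mk.injEq] at h
    obtain ⟨h1, h2⟩ := h
    change j = l at h1
    subst h1
    have h3 : a = b := Fin.ext (Fin.mk.inj (eq_of_heq h2))
    subst h3
    rfl
  have h1 := Fintype.card_le_of_injective _ hinj
  rw [Fintype.card_coe, Fintype.card_sigma] at h1
  refine h1.trans (le_of_eq ?_)
  simp only [Fintype.card_fin]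
  rw [Fin.sum_univ_eq_sum_range (fun i => i + 1) n]
  have h2 := Finset.sum_range_id (n + 1)
  rw [Finset.sum_range_succ'] at h2
  simpa [mul_comm] using h2

/-- A pivot row spans: antiderivatives of all entries are combinations of those of the pivots. -/
theorem exists_antiderivative_of_pivots {n : ℕ} {L : Fin n → Fin (n + 1) → E}
    {φ : E →ₐ[RatFunc C] F} {z : Fin n → Fin (n + 1) → F} (hz : ∀ j a, (z j a)′ = φ (L j a))
    (a : Fin (n + 1)) (j : Fin n) :
    ∃ y ∈ Submodule.span C {y | ∃ i ≤ j, toLex (a, i) ∈ pivots C L ∧ y = z i a},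
      y′ = φ (L j a) := by
  induction j using WellFoundedLT.induction with
  | _ j ih =>
    by_cases hp : toLex (a, j) ∈ pivots C L
    · exact ⟨z j a, Submodule.subset_span ⟨j, le_rfl, hp, rfl⟩, hz j a⟩
    rw [mem_pivots, not_not] at hp
    generalize L j a = x at hp ⊢
    induction hp using Submodule.span_induction with
    | mem x hx =>
      obtain ⟨i, hi, rfl⟩ := hx
      obtain ⟨y, hy, hy'⟩ := ih i hi
      refine ⟨y, Submodule.span_mono ?_ hy, hy'⟩
      rintro _ ⟨i', hi', h⟩
      exact ⟨i', hi'.trans (le_of_lt hi), h⟩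
    | zero => exact ⟨0, zero_mem _, by simp⟩
    | add x y _ _ hx hy =>
      obtain ⟨x', hx, ex⟩ := hx
      obtain ⟨y', hy, ey⟩ := hy
      exact ⟨x' + y', add_mem hx hy, by rw [map_add, map_add, ex, ey]⟩
    | smul c x _ hx =>
      obtain ⟨x', hx, ex⟩ := hx
      exact ⟨c • x', Submodule.smul_mem _ _ hx, by rw [deriv_smul_const, ex, map_smul_const]⟩

/-- Splitting the generators of a flag along the rows yields a well-generated tower. -/
theorem exists_wellGenerated_of_rows {n : ℕ} {s : Fin n → E} {k : Fin n → ℕ}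
    (hk : ∀ j, k j ≤ j) (hmono : Monotone k)
    {L : Fin n → Fin (n + 1) → E} (hrow : ∀ j a, L j a ∈ rowSpan C s a)
    (h0 : ∀ j (a : Fin (n + 1)), k j < a → L j a = 0) (hsum : ∀ j, (s j)′ = ∑ a, L j a)
    (hlead : ∀ (j : Fin n) (a : Fin (n + 1)), (a : ℕ) = k j →
      L j a ∉ Submodule.span C ((fun i => L i a) '' {i | i < j}))
    (hs : towerField C s n = ⊤)
    {φ : E →ₐ[RatFunc C] F} (hφ : ∀ x, φ x′ = (φ x)′)
    (hconst : ∀ f : F, f′ = 0 → f ∈ Set.range (algebraMap C F))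
    (hanti : ∀ j a, ∃ z : F, z′ = φ (L j a))
    (hgen : ∀ S : Subfield F, Set.range φ ⊆ S →
      (∀ z : F, (∃ j a, z′ = φ (L j a)) → z ∈ S) → S = ⊤) :
    ∃ (w : ℕ) (u : Fin w → F), n ≤ w ∧ w ≤ n * (n + 1) / 2 ∧ IsWellGenerated C u := by
  classical
  choose z hz using hanti
  have hkn : ∀ j, k j < n + 1 := fun j => (hk j).trans_lt (by omega)
  -- The lexicographic order lists the pivots row by row, and by column within a row.
  let e := (pivots C L).orderIsoOfFin rfl
  let a : Fin (pivots C L).card → Fin (n + 1) := fun i => (ofLex (e i).1).1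
  let b : Fin (pivots C L).card → Fin n := fun i => (ofLex (e i).1).2
  have hab : ∀ i, toLex (a i, b i) = (e i).1 := fun i => rfl
  let u : Fin (pivots C L).card → F := fun i => z (b i) (a i)
  have hu : ∀ i, (u i)′ = φ (L (b i) (a i)) := fun i => hz _ _
  have hpiv : ∀ i, L (b i) (a i) ∉
      Submodule.span C ((fun l => L l (a i)) '' {l | l < b i}) := fun i => mem_pivots.mp (e i).2
  -- `q l` is the position of the leading entry of column `l`, a pivot by `hlead`.
  let q : Fin n → Fin (pivots C L).card := fun l =>
    e.symm ⟨toLex (⟨k l, hkn l⟩, l), mem_pivots.mpr (hlead l _ rfl)⟩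
  have heq : ∀ l, (e (q l)).1 = toLex (⟨k l, hkn l⟩, l) := fun l => by
    simp only [q, OrderIso.apply_symm_apply]
  have haq : ∀ l, a (q l) = ⟨k l, hkn l⟩ := fun l => by simp only [a, heq]; rfl
  have hbq : ∀ l, b (q l) = l := fun l => by simp only [b, heq]; rfl
  have hlt : ∀ i j, i < j ↔ a i < a j ∨ a i = a j ∧ b i < b j := fun i j => by
    rw [← e.lt_iff_lt, ← Subtype.coe_lt_coe, ← hab, ← hab, Prod.Lex.toLex_lt_toLex]
  have hqlt : ∀ l l', l < l' → q l < q l' := fun l l' h => by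
    rw [hlt, haq, haq, hbq, hbq]
    rcases (hmono h.le).lt_or_eq with h' | h'
    · exact Or.inl h'
    · exact Or.inr ⟨Fin.ext h', h⟩
  have hqmono : StrictMono q := fun l l' h => hqlt l l' h
  have hcover : ∀ c l, toLex (c, l) ∈ pivots C L → ∃ i, a i = c ∧ b i = l := fun c l h =>
    ⟨e.symm ⟨_, h⟩, by simp only [a, OrderIso.apply_symm_apply]; rfl,
      by simp only [b, OrderIso.apply_symm_apply]; rfl⟩
  -- antiderivatives of the entries inside the new tower
  have hy : ∀ (j : Fin n) (c : Fin (n + 1)) (m : ℕ),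
      (∀ i, a i = c → b i ≤ j → (i : ℕ) < m) → ∃ y ∈ towerField C u m, y′ = φ (L j c) := by
    intro j c m hm
    obtain ⟨y, hy, hy'⟩ := exists_antiderivative_of_pivots hz c j
    refine ⟨y, ?_, hy'⟩
    refine (Submodule.span_le.mpr ?_ : _ ≤ constSubmodule (towerField C u m)) hy
    rintro _ ⟨l, hl, hp, rfl⟩
    obtain ⟨i, rfl, rfl⟩ := hcover c l hp
    exact mem_towerField u (hm i rfl hl)
  have hmemconst : ∀ (m : ℕ) (x y : F), y ∈ towerField C u m → x′ = y′ →
      x ∈ towerField C u m := by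
    intro m x y hy hxy
    obtain ⟨c, hc⟩ := hconst (x - y) (by rw [map_sub, hxy, sub_self])
    rw [← sub_add_cancel x y, ← hc]
    exact add_mem (algebraMap_mem_intermediateField _ c) hy
  -- Entries of column `l` below its leading row have antiderivatives from pivots in those rows, all
  -- listed before `q l`; entries above the leading row vanish.
  have hsq : ∀ l, φ (s l) - u (q l) ∈ towerField C u (q l) := by
    intro l
    have hex : ∀ c : Fin (n + 1), c ≠ a (q l) →
        ∃ y ∈ towerField C u (q l), y′ = φ (L l c) := by
      intro c hc
      rcases lt_or_gt_of_ne hc with h | h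
      · refine hy l c _ fun i hi _ => ?_
        rw [← Fin.lt_def, hlt]
        exact Or.inl (hi ▸ h)
      · refine ⟨0, zero_mem _, ?_⟩
        rw [haq] at h
        rw [h0 l c h, map_zero, map_zero]
    choose! y hy hy' using hex
    refine hmemconst _ _ (∑ c ∈ Finset.univ.erase (a (q l)), y c)
      (sum_mem fun c hc => hy c (Finset.ne_of_mem_erase hc)) ?_
    rw [map_sub, ← hφ, hsum, hu, hbq, map_sum, map_sum, ← Finset.add_sum_erase _ _
      (Finset.mem_univ (a (q l))), add_sub_cancel_left]
    exact Finset.sum_congr rfl fun c hc => (hy' c (Finset.ne_of_mem_erase hc)).symm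
  have hsmem : ∀ l m, (q l : ℕ) < m → φ (s l) ∈ towerField C u m := fun l m hm => by
    rw [← sub_add_cancel (φ (s l)) (u (q l))]
    exact add_mem (towerField_mono u hm.le (hsq l)) (mem_towerField u hm)
  have hfield : ∀ (l m : ℕ), (∀ i : Fin n, (i : ℕ) < l → (q i : ℕ) < m) →
      ∀ x ∈ towerField C s l, φ x ∈ towerField C u m := by
    intro l m hlm x hx
    have : towerField C s l ≤ (towerField C u m).comap φ :=
      (towerField_le_iff s).mpr fun i hi => hsmem i m (hlm i hi)
    exact this hx
  -- Old row `l.succ`, built on `s l`, becomes the new row built on `u (q l)`.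
  let κ : Fin (pivots C L).card → Fin ((pivots C L).card + 1) := fun i =>
    Fin.cases 0 (fun l => (q l).succ) (a i)
  have hκ0 : ∀ i, a i = 0 → κ i = 0 := fun i hi => by simp only [κ, hi, Fin.cases_zero]
  have hκs : ∀ i l, a i = Fin.succ l → κ i = (q l).succ := fun i l hi => by
    simp only [κ, hi, Fin.cases_succ]
  have hκ : StrictMono (Fin.cases 0 (fun l => (q l).succ) :
      Fin (n + 1) → Fin ((pivots C L).card + 1)) := by
    intro x y hxy
    induction y using Fin.cases with
    | zero => exact absurd hxy (Fin.not_lt_zero _)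
    | succ y =>
      induction x using Fin.cases with
      | zero => exact Fin.succ_pos _
      | succ x => exact Fin.succ_lt_succ_iff.mpr (hqlt x y (Fin.succ_lt_succ_iff.mp hxy))
  have hrowT : IsRowTower (C := C) u κ := by
    refine ⟨fun i => ?_, fun i => ?_, fun r c hc hsum0 => ?_⟩
    · rcases Fin.eq_zero_or_eq_succ (a i) with h | ⟨l, h⟩
      · rw [hκ0 i h]; exact Nat.zero_le _
      · rw [hκs i l h, Fin.val_succ, Nat.succ_le_iff, ← Fin.lt_def, hlt, h, haq]
        -- `u (q l)` precedes every generator from row `l.succ`, because its own row `k l` is at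
        -- most `l`.
        exact Or.inl (Nat.lt_succ_of_le (hk l))
    · rw [hu]
      have hmem := hrow (b i) (a i)
      rcases Fin.eq_zero_or_eq_succ (a i) with h | ⟨l, h⟩
      · rw [hκ0 i h]
        rw [h] at hmem ⊢
        exact map_mem_rowSpan_zero hφ s u hmem
      · rw [hκs i l h]
        rw [h] at hmem ⊢
        exact map_mem_rowSpan_succ hφ (hfield _ _ fun i hi => Fin.lt_def.mp (hqlt _ _ hi))
          (hsq l) hmem
    · refine eq_zero_of_notMem_span_initial (x := fun i => L (b i) (a i)) (κ := κ) ?_ r hc ?_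
      · intro j hj
        refine hpiv j (Submodule.span_mono ?_ hj)
        rintro _ ⟨i, ⟨hi, hij⟩, rfl⟩
        have haij : a i = a j := hκ.injective hi
        refine ⟨b i, ?_, by simp only [haij]⟩
        rcases (hlt i j).mp hij with h | h
        · exact absurd h (haij ▸ lt_irrefl _)
        · exact h.2
      · apply φ.injective
        change φ _ = φ _
        rw [map_sum, map_zero, ← hsum0]
        exact Finset.sum_congr rfl fun i _ => by rw [map_smul_const, hu]
  have htop : towerField C u (pivots C L).card = ⊤ := by
    have hS := hgen (towerField C u (pivots C L).card).toSubfield ?_ ?_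
    · exact eq_top_iff.mpr fun x _ => (hS ▸ Subfield.mem_top x :
        x ∈ (towerField C u (pivots C L).card).toSubfield)
    · rintro _ ⟨x, rfl⟩
      exact hfield n _ (fun i _ => (q i).2) x (by rw [hs]; trivial)
    · rintro x ⟨j, c, hx⟩
      obtain ⟨y, hy, hy'⟩ := hy j c _ fun i _ _ => i.2
      exact hmemconst _ x y hy (hx.trans hy'.symm)
  refine ⟨_, u, ?_, card_pivots_le hk h0, hrowT.isWellGenerated ?_ hconst htop⟩
  · simpa using Fintype.card_le_of_injective q hqmono.injective
  · intro i j hij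
    apply hκ.monotone
    rcases hij.lt_or_eq with h | rfl
    · rcases (hlt i j).mp h with h | h
      · exact h.le
      · exact h.1.le
    · exact le_rfl

end Splitting

/-- Quotients of pairs of polynomials over `C(x)` exhaust `E`, so the extension can be built in the
universe of `C`. -/
theorem small_of_towerField_eq_top {C : Type u} [Field C] {E : Type v} [Field E] [Algebra C E]
    [Algebra (RatFunc C) E] {n : ℕ} (t : Fin n → E) (h : towerField C t n = ⊤) : Small.{u} E := by
  refine small_of_surjective (α := MvPolynomial (Fin n) (RatFunc C) × MvPolynomial (Fin n) (RatFunc C))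
    (f := fun p => MvPolynomial.aeval t p.1 / MvPolynomial.aeval t p.2) fun x => ?_
  have hx : x ∈ towerField C t n := by rw [h]; trivial
  have e : t '' {j | (j : ℕ) < n} = Set.range t := by
    rw [← Set.image_univ]
    congr 1
    ext j
    simp
  rw [towerField, e, IntermediateField.mem_adjoin_range_iff] at hx
  obtain ⟨p, q, hpq⟩ := hx
  exact ⟨(p, q), hpq.symm⟩

end LogTower

end

theorem theorem5p6 {C : Type u} [Field C] [CharZero C]
    {E : Type v} [Field E] [Algebra C E] [Algebra (RatFunc C) E] [IsScalarTower C (RatFunc C) E]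
    [Differential E] [DifferentialAlgebra (RatFunc C) E]
    {n : ℕ} (t : Fin n → E) (ht : LogTower.IsLogarithmicTower C t) :
    ∃ (F : Type u) (_ : Field F) (_ : Algebra C F) (_ : Algebra (RatFunc C) F)
      (_ : IsScalarTower C (RatFunc C) F)
      (_ : Differential F) (_ : DifferentialAlgebra (RatFunc C) F)
      (w : ℕ) (u : Fin w → F) (φ : E →ₐ[RatFunc C] F),
      n ≤ w ∧ w ≤ n * (n + 1) / 2 ∧
        LogTower.IsWellGenerated C u ∧
        Function.Injective φ ∧ ∀ f : E, φ f′ = (φ f)′ := by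
  classical
  obtain ⟨s, k, h⟩ := LogTower.exists_flag ht
  have hrows := fun j : Fin n => LogTower.exists_rows_of_mem_logDerivSpan s
    ((h.le j j.2).trans j.2.le) (h.deriv_mem j j.2)
  choose L hrow h0 hsum using hrows
  have hsmall := LogTower.small_of_towerField_eq_top t ht.generates
  have hE : CharZero E := charZero_of_injective_algebraMap (algebraMap C E).injective
  obtain ⟨F, _, _, ι, hι, hconst, hanti, hgen⟩ := LogTower.exists_antiderivatives_extension.{u}
    (Finset.univ.image fun p : Fin n × Fin (n + 1) => L p.1 p.2)
  let _ : Algebra C F := (ι.comp (algebraMap C E)).toAlgebra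
  let _ : Algebra (RatFunc C) F := (ι.comp (algebraMap (RatFunc C) E)).toAlgebra
  have hT : IsScalarTower C (RatFunc C) F := IsScalarTower.of_algebraMap_eq fun c =>
    congrArg ι (IsScalarTower.algebraMap_apply C (RatFunc C) E c)
  have hD : DifferentialAlgebra (RatFunc C) F := ⟨fun a => by
    change (ι _)′ = ι _
    rw [← hι, deriv_algebraMap]⟩
  let φ : E →ₐ[RatFunc C] F := { ι with commutes' := fun _ => rfl }
  have hs : LogTower.towerField C s n = ⊤ := by
    rw [eq_top_iff, ← ht.generates, LogTower.towerField_le_iff]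
    intro j _
    have hj : t j ∈ Submodule.span C (Set.range s) := by
      rw [h.span_eq ht]; exact Submodule.subset_span ⟨j, rfl⟩
    have e : Set.range s = s '' {i | (i : ℕ) < n} := by
      rw [← Set.image_univ]
      congr 1
      ext i
      simp
    rw [e] at hj
    exact LogTower.span_le_constSubmodule hj
  -- Constants of `F` come from `E`, and those of a logarithmic tower lie in `C`.
  have hF : ∀ f : F, f′ = 0 → f ∈ Set.range (algebraMap C F) := by
    intro f hf
    obtain ⟨x, rfl⟩ := hconst f hf
    rw [← hι, map_eq_zero] at hf
    obtain ⟨c, rfl⟩ := LogTower.mem_range_of_deriv_eq_zero_of_tower ht hf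
    exact ⟨c, rfl⟩
  have hgen' : ∀ S : Subfield F, Set.range φ ⊆ S →
      (∀ z : F, (∃ j a, z′ = φ (L j a)) → z ∈ S) → S = ⊤ := by
    intro S hS hzS
    refine hgen S hS fun z hz => hzS z ?_
    obtain ⟨x, hx, e⟩ := hz
    obtain ⟨p, -, rfl⟩ := Finset.mem_image.mp hx
    exact ⟨p.1, p.2, e⟩
  obtain ⟨w, u, hw, hw', hu⟩ := LogTower.exists_wellGenerated_of_rows (φ := φ)
    (fun j => h.le j j.2) h.monotone hrow h0 hsum (h.leading_notMem ht hrow h0 hsum) hs hι hF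
    (fun j a => hanti _ (Finset.mem_image_of_mem _ (Finset.mem_univ (j, a)))) hgen'
  exact ⟨F, _, _, _, hT, _, hD, w, u, φ, hw, hw', hu, φ.injective, hι⟩
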